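/- Let $R$ be a finite chain ring (associative with $1\neq 0$, not necessarily commutative, whose left ideals form a chain and whose right ideals form a chain) of length $2$, i.e. $\operatorname{rad}R\neq 0$ and $(\operatorname{rad}R)^2=0$, and let $q=|R/\operatorname{rad}R|$. Let $\mathrm{PHG}(2,R)$ be the right projective Hjelmslev plane over $R$: its points and lines are the free submodules of rank $1$ and rank $2$, respectively, of the right module $R^3$, and incidence is inclusion. A $(k,n)$-arc is a set of $k$ points that meets every line in at most $n$ points, and $\mathrm{m}_n(R)$ is the largest $k$ for which a $(k,n)$-arc exists. Two points are neighbours if their images in $(R/\operatorname{rad}R)^3$ coincide; the equivalence classes are the point classes, and the nonempty intersections of a line with a point class are the line segments. Let $n$ be an integer with $q^2-q\le n\le q^2-2$, and write $n=q^2-q+t$ with $t\in\{0,1,\dots,q-2\}$. Then there exists a $(q^2n-2q,\,n)$-arc in $\mathrm{PHG}(2,R)$. More precisely, such an arc can be chosen as the union of $qn-2$ pairwise disjoint line segments, arranged around a point class $[z]$ in the following sense: exactly $t$ of these segments lie in $[z]$, and every other point class contains at least $q-3$ and at most $q-1$ of them. Consequently, $$\mathrm{m}_n(R)\ \ge\ q(q+1)n-q^3+q(q-2-t).$$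 -/

import Mathlib

/-- A chain ring: a ring with `1 ≠ 0` (not necessarily commutative) whose left ideals form a chain
and whose right ideals form a chain. -/
structure IsChainRing (R : Type*) [Ring R] : Prop where
  nontrivial : Nontrivial R
  left_chain : ∀ I J : Submodule R R, I ≤ J ∨ J ≤ I
  right_chain : ∀ I J : Submodule Rᵐᵒᵖ R, I ≤ J ∨ J ≤ I

/-- A chain ring of length (nilpotency index) two: `rad R ≠ 0` and `(rad R)² = 0`, where `rad R` is
the Jacobson radical. -/
structure IsChainRingOfLengthTwo (R : Type*) [Ring R] : Prop extends IsChainRing R where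
  rad_ne_bot : Ring.jacobson R ≠ ⊥
  rad_mul_rad : ∀ a ∈ Ring.jacobson R, ∀ b ∈ Ring.jacobson R, a * b = 0

/-- The order of the residue field `R / rad R`, usually written `q`. -/
noncomputable def residueOrder (R : Type*) [Ring R] : ℕ := Nat.card (R ⧸ Ring.jacobson R)

namespace PHG

/-- A submodule of the right module `R³` (a module over the opposite ring) is free of rank `k` if it
has a basis with `k` elements. -/
def IsFreeOfRank (R : Type*) [Ring R] (k : ℕ) (N : Submodule Rᵐᵒᵖ (Fin 3 → R)) : Prop :=
  Nonempty (Module.Basis (Fin k) Rᵐᵒᵖ N)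

/-- Points of the right projective Hjelmslev plane `PHG(2,R)`: free rank `1` submodules of the right
module `R³`. -/
def Point (R : Type*) [Ring R] : Type _ :=
  {N : Submodule Rᵐᵒᵖ (Fin 3 → R) // IsFreeOfRank R 1 N}

/-- Lines of `PHG(2,R)`: free rank `2` submodules of the right module `R³`. -/
def Line (R : Type*) [Ring R] : Type _ :=
  {N : Submodule Rᵐᵒᵖ (Fin 3 → R) // IsFreeOfRank R 2 N}

variable {R : Type*} [Ring R]

/-- The set of points on a line; incidence is inclusion of submodules. -/
def Line.points (L : Line R) : Set (Point R) := {x | x.1 ≤ L.1}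

/-- The canonical projection `R³ → (R / rad R)³`. -/
def residueMap (R : Type*) [Ring R] (v : Fin 3 → R) : Fin 3 → R ⧸ Ring.jacobson R :=
  fun i => Submodule.Quotient.mk (v i)

/-- Two points are neighbours if their images in `(R / rad R)³` coincide. -/
def Neighbour (x y : Point R) : Prop :=
  residueMap R '' (x.1 : Set (Fin 3 → R)) = residueMap R '' (y.1 : Set (Fin 3 → R))

/-- The neighbour class `[x]` of a point. -/
def pointClass (x : Point R) : Set (Point R) := {y | Neighbour y x}

/-- Line segments: the nonempty intersections of a line with a point class. -/
def IsLineSegment (S : Set (Point R)) : Prop :=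
  S.Nonempty ∧ ∃ (L : Line R) (x : Point R), S = L.points ∩ pointClass x

/-- A (projective) `(k,n)`-arc: a set of `k` points meeting every line in at most `n` points. -/
def IsArc (K : Set (Point R)) (k n : ℕ) : Prop :=
  K.ncard = k ∧ ∀ L : Line R, (K ∩ L.points).ncard ≤ n

/-- `m_n(R)`: the largest size of a (projective) `(k,n)`-arc in `PHG(2,R)`; see
`isGreatest_maxArcSize`. -/
noncomputable def maxArcSize (R : Type*) [Ring R] (n : ℕ) : ℕ :=
  sSup {k | ∃ K : Set (Point R), IsArc K k n}

instance [Finite R] : Finite (Point R) := by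
  unfold Point
  have : Finite (Submodule Rᵐᵒᵖ (Fin 3 → R)) :=
    Finite.of_injective (fun N => (N : Set (Fin 3 → R))) SetLike.coe_injective
  infer_instance

/-- For a finite ring the supremum defining `m_n(R)` is a maximum. -/
theorem isGreatest_maxArcSize [Finite R] (n : ℕ) :
    IsGreatest {k | ∃ K : Set (Point R), IsArc K k n} (maxArcSize R n) := by
  have hb : BddAbove {k | ∃ K : Set (Point R), IsArc K k n} := by
    refine ⟨Nat.card (Point R), ?_⟩
    rintro k ⟨K, rfl, -⟩
    exact Set.ncard_le_card K
  have hne : {k | ∃ K : Set (Point R), IsArc K k n}.Nonempty :=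
    ⟨0, ∅, by simp [IsArc]⟩
  exact ⟨Nat.sSup_mem hne hb, fun k hk => le_csSup hb hk⟩

end PHG

/-! Fix `θ ≠ 0` in the radical. Every element of `R` is uniquely `s a + θ b` with `a`, `b` in the
residue ring `K`, so normalised homogeneous coordinates turn points into tuples over `K`. One
direction is chosen in each point class, cutting it into `q` parallel segments of `q` points. Let
`[z]` be the class of `(0, 0, 1)`, let `T` consist of `t` elements other than `0, 1`, and let `O =
{0, 1} ∪ T`. Affine classes `(y, w)` with `y ∈ O` have their segments directed to the class `y` on
`x₀ = 0`. In the other classes outside `[z]` they point to `[z]`, and in `[z]` they run along `x₀ =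
0`.

The arc omits one segment from an affine class with `y ∈ O` and two from any other affine class. On
`x₀ = 0` it omits three from the class `w` if `w ∈ O` and two otherwise. In `[z]` it keeps the
segments with label in `T`. This leaves `qn - 2` segments.

A line meets a class either across the segments, in one point of each, or along one of them, in `q`
points or none. Lines missing `[z]` satisfy the bound by a direct count (`card_onLineTwo_le`). Lines
through `[z]` can run along segments in `q` classes, so the gaps are placed such that every such
line hits enough of them: one gap in general (`exists_gap`), two if the line also contains a full
segment in `[z]` (`exists_two_gaps`). For `q = 2` there is no room for three gaps, and two segments
are exhibited separately. -/

namespace PHG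

/-! ### Coordinates of points, segments and lines over the residue division ring. -/

section Combinatorics

/-- Coordinates of points: `(y, η, w, ω)` stands for `(1, y + θη, w + θω)`, `(r, w, ω)` for
`(θr, 1, w + θω)` and `(r, s)` for `(θr, θs, 1)`. -/
abbrev Coord (K : Type*) := (K × K × K × K) ⊕ (K × K × K) ⊕ (K × K)

/-- Labels of line segments, one parallel class of segments for each point class. -/
abbrev Label (K : Type*) := (K × K × K) ⊕ (K × K) ⊕ K

/-- Coordinates of point classes: the points of the projective plane over `K`. -/
abbrev ClassCoord (K : Type*) := (K × K) ⊕ K ⊕ Unit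

variable {K : Type*}

/-- The class of a point. -/
def Coord.toClass : Coord K → ClassCoord K
  | .inl (y, _, w, _) => .inl (y, w)
  | .inr (.inl (_, w, _)) => .inr (.inl w)
  | .inr (.inr _) => .inr (.inr ())

/-- The class containing a segment. -/
def Label.toClass : Label K → ClassCoord K
  | .inl (y, w, _) => .inl (y, w)
  | .inr (.inl (w, _)) => .inr (.inl w)
  | .inr (.inr _) => .inr (.inr ())

variable [DivisionRing K] [DecidableEq K]

/-- The label of the segment through a point, where the segments in the class `(y, w)` are directed
towards the class `y` on the line `x₀ = 0` if `y ∈ O`, and all other segments lie on lines through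
the class of `(0, 0, 1)`. -/
def Coord.label (σ : K → K) (O : Finset K) : Coord K → Label K
  | .inl (y, η, w, ω) => .inl (y, w, if y ∈ O then ω - σ y * η else η)
  | .inr (.inl (r, w, _)) => .inr (.inl (w, r))
  | .inr (.inr (r, _)) => .inr (.inr r)

/-- Parametrization of the segment with a given label. -/
def Label.param (σ : K → K) (O : Finset K) : Label K → K → Coord K
  | .inl (y, w, τ), k => if y ∈ O then .inl (y, k, w, τ + σ y * k) else .inl (y, τ, w, k)
  | .inr (.inl (w, r)), k => .inr (.inl (r, w, k))
  | .inr (.inr r), k => .inr (.inr (r, k))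

/-- Points on a line with equation `x₂ = α x₀ + β x₁`. -/
def OnLineTwo (σ : K → K) (a b d : K) (c : K → K) : Coord K → Prop
  | .inl (y, η, w, ω) => w = a + b * y ∧ ω = σ b * η + c y
  | .inr (.inl (r, w, ω)) => w = b ∧ ω = σ a * r + d
  | .inr (.inr _) => False

/-- Points on a line with equation `x₁ = α x₀ + θρ x₂`. -/
def OnLineOne (σ : K → K) (a d ρ : K) : Coord K → Prop
  | .inl (y, η, w, _) => y = a ∧ η = d + ρ * w
  | .inr (.inl _) => False
  | .inr (.inr (r, s)) => s = σ a * r + ρ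

/-- Points on a line with equation `x₀ = θδ x₁ + θρ x₂`. -/
def OnLineZero (δ ρ : K) : Coord K → Prop
  | .inl _ => False
  | .inr (.inl (r, w, _)) => r = δ + ρ * w
  | .inr (.inr (r, _)) => r = ρ

theorem Coord.toClass_label (σ : K → K) (O : Finset K) (p : Coord K) :
    (p.label σ O).toClass = p.toClass := by
  rcases p with ⟨y, η, w, ω⟩ | ⟨r, w, ω⟩ | ⟨r, s⟩ <;> rfl

/-- Links the two descriptions of a segment, as a fibre of `label` and as a curve parametrised by
`K`; with `Label.param_injective` it gives `q` points per segment. -/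
theorem Coord.label_eq_iff (σ : K → K) (O : Finset K) (p : Coord K) (l : Label K) :
    p.label σ O = l ↔ ∃ k, l.param σ O k = p := by
  rcases p with ⟨y, η, w, ω⟩ | ⟨r, w, ω⟩ | ⟨r, s⟩ <;>
  rcases l with ⟨y', w', τ⟩ | ⟨w', r'⟩ | r'
  · simp only [Coord.label, Label.param]
    by_cases h : y' ∈ O
    · simp only [h, if_true, Sum.inl.injEq, Prod.mk.injEq]
      constructor
      · rintro ⟨rfl, rfl, h'⟩
        rw [if_pos h] at h'
        exact ⟨η, rfl, rfl, rfl, by rw [← h']; abel⟩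
      · rintro ⟨k, rfl, rfl, rfl, rfl⟩
        exact ⟨rfl, rfl, by rw [if_pos h]; abel⟩
    · simp only [h, if_false, Sum.inl.injEq, Prod.mk.injEq]
      constructor
      · rintro ⟨rfl, rfl, h'⟩
        rw [if_neg h] at h'
        exact ⟨ω, rfl, h'.symm, rfl, rfl⟩
      · rintro ⟨k, rfl, rfl, rfl, rfl⟩
        exact ⟨rfl, rfl, by rw [if_neg h]⟩
  all_goals simp only [Coord.label, Label.param]
  all_goals try split_ifs
  all_goals simp
  all_goals tauto

theorem Label.param_injective (σ : K → K) (O : Finset K) (l : Label K) :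
    Function.Injective (l.param σ O) := by
  intro k k' h
  rcases l with ⟨y, w, τ⟩ | ⟨w, r⟩ | r
  · by_cases hy : y ∈ O <;> simp_all [Label.param]
  all_goals simp_all [Label.param]

end Combinatorics

/-! ### Elementary counting. -/

section Counting

open Finset

/-- Used for lines through `[z]`: `B × α` parametrises the points outside `[z]`, and `C` those
inside. -/
theorem card_le_of_subset_image {α β : Type*} [Fintype α] [DecidableEq β] {s : Finset β}
    (B C : Finset α)
    (f : (α × α) ⊕ α → β)
    (hs : s ⊆ ((B ×ˢ univ).disjSum C).image f) : #s ≤ #B * Fintype.card α + #C := by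
  refine ((card_le_card hs).trans card_image_le).trans ?_
  rw [card_disjSum, card_product, card_univ]

variable {α : Type*} [Fintype α] [DecidableEq α]

theorem card_filter_ne (a : α) : #{x : α | x ≠ a} + 1 = Fintype.card α := by
  have := Finset.card_erase_add_one (mem_univ a)
  rw [← card_univ, ← this]
  congr 2; ext; simp

theorem card_filter_ne_ne {a b : α} (h : a ≠ b) :
    #{x : α | x ≠ a ∧ x ≠ b} + 2 = Fintype.card α := by
  have h1 := Finset.card_compl_add_card {a, b}
  rw [card_pair h] at h1
  rw [← h1]
  congr 2; ext; simp

theorem card_filter_ne_ne_ne {a b c : α} (hab : a ≠ b) (hac : a ≠ c) (hbc : b ≠ c) :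
    #{x : α | x ≠ a ∧ x ≠ b ∧ x ≠ c} + 3 = Fintype.card α := by
  have h1 := Finset.card_compl_add_card {a, b, c}
  rw [card_eq_three.2 ⟨a, b, c, hab, hac, hbc, rfl⟩] at h1
  rw [← h1]
  congr 2; ext; simp

theorem sum_ite_mem_card (s : Finset α) : ∑ y : α, (if y ∈ s then 1 else 0) = #s := by
  simp

end Counting

/-! ### The choice of segments and the bound for each type of line. -/

section Arc

variable {K : Type*} [DivisionRing K] [DecidableEq K]

/-- The second missing segment in the classes of blocking lines. -/
def secondGap (w : K) : K := if w = 0 then 1 else w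

/-- The third missing segment in the exceptional classes on the line `x₀ = 0`. -/
def thirdGap (e w : K) : K := if w = 0 ∨ w = 1 then e else w * w

theorem secondGap_ne_zero (w : K) : secondGap w ≠ 0 := by
  unfold secondGap; split_ifs with h
  · exact one_ne_zero
  · exact h

theorem thirdGap_ne_zero {e : K} (he : e ≠ 0) (w : K) : thirdGap e w ≠ 0 := by
  unfold thirdGap; split_ifs with h
  · exact he
  · exact mul_self_ne_zero.2 fun h' => h (Or.inl h')

theorem thirdGap_ne_secondGap {e : K} (he : e ≠ 1) (w : K) : thirdGap e w ≠ secondGap w := by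
  unfold thirdGap secondGap
  by_cases h0 : w = 0
  · simp [h0, he]
  by_cases h1 : w = 1
  · simpa [h1] using he
  simp [h0, h1]

/-- The classes on `x₀ = 0` at which the segments outside the blocking lines are directed. -/
def exceptional (T : Finset K) : Finset K := insert 0 (insert 1 T)

/-- The segments making up the arc. -/
def Label.Chosen (T : Finset K) (e : K) : Label K → Prop
  | .inl (y, w, τ) => τ ≠ 0 ∧ (y ∉ exceptional T → τ ≠ secondGap w)
  | .inr (.inl (w, r)) => r ≠ 0 ∧ r ≠ secondGap w ∧ (w ∈ exceptional T → r ≠ thirdGap e w)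
  | .inr (.inr r) => r ∈ T

instance (T : Finset K) (e : K) : DecidablePred (Label.Chosen T e)
  | .inl (y, w, τ) => inferInstanceAs (Decidable (τ ≠ 0 ∧ (y ∉ exceptional T → τ ≠ secondGap w)))
  | .inr (.inl (w, r)) => inferInstanceAs (Decidable
      (r ≠ 0 ∧ r ≠ secondGap w ∧ (w ∈ exceptional T → r ≠ thirdGap e w)))
  | .inr (.inr r) => inferInstanceAs (Decidable (r ∈ T))

variable [Fintype K]

open Finset

theorem card_exceptional {T : Finset K} (h0 : 0 ∉ T) (h1 : 1 ∉ T) :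
    #(exceptional T) = #T + 2 := by
  unfold exceptional
  rw [card_insert_of_notMem (by simp [h0]), card_insert_of_notMem h1]

theorem card_chosen_of_mem {T : Finset K} {y : K} (hy : y ∈ exceptional T) (w : K) :
    #{τ : K | τ ≠ 0 ∧ (y ∉ exceptional T → τ ≠ secondGap w)} + 1 = Fintype.card K := by
  rw [← card_filter_ne (0 : K)]; simp [hy]

theorem card_chosen_of_notMem {T : Finset K} {y : K} (hy : y ∉ exceptional T) (w : K) :
    #{τ : K | τ ≠ 0 ∧ (y ∉ exceptional T → τ ≠ secondGap w)} + 2 = Fintype.card K := by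
  rw [← card_filter_ne_ne (secondGap_ne_zero w).symm]; simp [hy]

theorem card_chosen_zero (T : Finset K) {e : K} (h0 : e ≠ 0) (h1 : e ≠ 1) (w : K) :
    #{r : K | r ≠ 0 ∧ r ≠ secondGap w ∧ (w ∈ exceptional T → r ≠ thirdGap e w)} +
      (2 + if w ∈ exceptional T then 1 else 0) = Fintype.card K := by
  by_cases h : w ∈ exceptional T
  · simp only [h, forall_const, if_true]
    exact card_filter_ne_ne_ne (secondGap_ne_zero w).symm (thirdGap_ne_zero h0 w).symm
      (thirdGap_ne_secondGap h1 w).symm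
  · simp only [h, false_imp_iff, and_true, if_false]
    exact card_filter_ne_ne (secondGap_ne_zero w).symm

/-- The number of chosen segments in a class. -/
theorem card_chosen_inl (T : Finset K) (y w : K) :
    #{τ : K | τ ≠ 0 ∧ (y ∉ exceptional T → τ ≠ secondGap w)} + 2 =
      Fintype.card K + if y ∈ exceptional T then 1 else 0 := by
  by_cases h : y ∈ exceptional T
  · have := card_chosen_of_mem h w
    rw [if_pos h]; omega
  · have := card_chosen_of_notMem h w
    rw [if_neg h]; omega

/-- The total number of chosen segments. -/
theorem card_chosen {T : Finset K} {e : K} (h0 : e ≠ 0) (h1 : e ≠ 1) (hT0 : 0 ∉ T) (hT1 : 1 ∉ T)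
    {n : ℕ} (hn : n + Fintype.card K = Fintype.card K ^ 2 + #T) :
    #{l : Label K | l.Chosen T e} + 2 = Fintype.card K * n := by
  set q := Fintype.card K with hq
  have hO := card_exceptional hT0 hT1
  have e1 : ∑ y : K, ∑ w : K, #{τ : K | τ ≠ 0 ∧ (y ∉ exceptional T → τ ≠ secondGap w)} + 2 * q * q
      = q * q * q + q * (#T + 2) := by
    have : ∑ y : K, ∑ w : K, (#{τ : K | τ ≠ 0 ∧ (y ∉ exceptional T → τ ≠ secondGap w)} + 2)
      = ∑ y : K, ∑ w : K, (q + if y ∈ exceptional T then 1 else 0) := by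
      simp only [card_chosen_inl, hq]
    simp only [sum_add_distrib, sum_const, card_univ, smul_eq_mul, ← hq, ← mul_sum,
      sum_ite_mem_card, hO] at this
    linarith
  have e2 : ∑ w : K, #{r : K | r ≠ 0 ∧ r ≠ secondGap w ∧
      (w ∈ exceptional T → r ≠ thirdGap e w)} + (2 * q + (#T + 2)) = q * q := by
    have : ∑ w : K, (#{r : K | r ≠ 0 ∧ r ≠ secondGap w ∧
      (w ∈ exceptional T → r ≠ thirdGap e w)} +
      (2 + if w ∈ exceptional T then 1 else 0)) = ∑ w : K, q := by
      simp only [card_chosen_zero T h0 h1, hq]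
    simp only [sum_add_distrib, sum_const, card_univ, smul_eq_mul, ← hq,
      sum_ite_mem_card, hO] at this
    linarith
  have e3 : #{l : Label K | l.Chosen T e} =
      ∑ y : K, ∑ w : K, #{τ : K | τ ≠ 0 ∧ (y ∉ exceptional T → τ ≠ secondGap w)} +
      (∑ w : K, #{r : K | r ≠ 0 ∧ r ≠ secondGap w ∧ (w ∈ exceptional T → r ≠ thirdGap e w)} +
        #T) := by
    simp only [card_filter, Fintype.sum_sum_type, Fintype.sum_prod_type]
    congr 2
    rw [← sum_ite_mem_card T]; rfl
  rw [e3]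
  zify at *
  linear_combination e1 + e2 - (q : ℤ) * hn

theorem card_filter_affine_ne {a b : K} (h : a ≠ 0) :
    #{x : K | a * x + b ≠ 0} + 1 = Fintype.card K := by
  rw [← card_filter_ne (-(a⁻¹ * b))]
  congr 2; ext x
  simp only [mem_filter, mem_univ, true_and, ne_eq, not_iff_not]
  constructor
  · intro h'
    have : x = a⁻¹ * (a * x) := by rw [inv_mul_cancel_left₀ h]
    rw [this, eq_neg_of_add_eq_zero_left h', mul_neg]
  · rintro rfl
    rw [mul_neg, mul_inv_cancel_left₀ h, neg_add_cancel]

/-- Such a line meets one class `(y, a + b y)` for each `y`, and the class `b` on `x₀ = 0`. It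
crosses all segments unless `y = b ∈ O`, where it runs parallel to them and may gain one point; the
third gap in the class `b` compensates. -/
theorem card_onLineTwo_le {σ : K → K} (hσ : Function.Injective σ) {T : Finset K} {e : K}
    (h0 : e ≠ 0) (h1 : e ≠ 1) (hT0 : 0 ∉ T) (hT1 : 1 ∉ T) {n : ℕ}
    (hn : n + Fintype.card K = Fintype.card K ^ 2 + #T) (a b d : K) (c : K → K) 
    (s : Finset (Coord K)) (hs : ∀ p ∈ s, (p.label σ (exceptional T)).Chosen T e)
    (hs' : ∀ p ∈ s, OnLineTwo σ a b d c p) : #s ≤ n := by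
  set q := Fintype.card K with hq
  have hO := card_exceptional hT0 hT1
  let A : Finset (K × K) := {x | if x.1 ∈ exceptional T then (σ b - σ x.1) * x.2 + c x.1 ≠ 0 else
    (x.2 ≠ 0 ∧ (x.1 ∉ exceptional T → x.2 ≠ secondGap (a + b * x.1)))}
  let B : Finset K := {r | r ≠ 0 ∧ r ≠ secondGap b ∧ (b ∈ exceptional T → r ≠ thirdGap e b)}
  let f : (K × K) ⊕ K → Coord K := Sum.elim
    (fun x => .inl (x.1, x.2, a + b * x.1, σ b * x.2 + c x.1))
    (fun r => .inr (.inl (r, b, σ a * r + d)))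
  have hsA : s ⊆ (A.disjSum B).image f := by
    intro p hp
    have hp1 := hs p hp
    have hp2 := hs' p hp
    rw [mem_image]
    rcases p with ⟨y, η, w, ω⟩ | ⟨r, w, ω⟩ | ⟨r, z⟩
    · obtain ⟨rfl, rfl⟩ := hp2
      refine ⟨.inl (y, η), ?_, rfl⟩
      simp only [A, inl_mem_disjSum, mem_filter, mem_univ, true_and]
      by_cases hy : y ∈ exceptional T
      · simp only [Coord.label, Label.Chosen, hy, if_true] at hp1 ⊢
        convert hp1.1 using 1
        rw [sub_mul]; abel
      · simpa only [Coord.label, Label.Chosen, hy, if_false] using hp1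
    · obtain ⟨rfl, rfl⟩ := hp2
      refine ⟨.inr r, ?_, rfl⟩
      simp only [B, inr_mem_disjSum, mem_filter, mem_univ, true_and]
      exact hp1
    · exact hp2.elim
  have hA : #A = ∑ y : K, #{η : K | if y ∈ exceptional T then (σ b - σ y) * η + c y ≠ 0 else
        (η ≠ 0 ∧ (y ∉ exceptional T → η ≠ secondGap (a + b * y)))} := by
    simp only [A, card_filter, Fintype.sum_prod_type]
  -- The count is `q - 2`, plus one for `y ∈ O`, plus one more in the parallel case `y = b ∈ O`.
  have hy : ∀ y : K, #{η : K | if y ∈ exceptional T then (σ b - σ y) * η + c y ≠ 0 else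
        (η ≠ 0 ∧ (y ∉ exceptional T → η ≠ secondGap (a + b * y)))} + 2 ≤
      q + (if y ∈ exceptional T then 1 else 0) +
        (if y = b then (if b ∈ exceptional T then 1 else 0) else 0) := by
    intro y
    by_cases hy : y ∈ exceptional T
    · simp only [hy, if_true]
      by_cases hyb : y = b
      · subst hyb
        simp only [hy, if_true]
        have := card_le_univ (filter (fun η => (σ y - σ y) * η + c y ≠ 0) univ)
        omega
      · have hne : σ b - σ y ≠ 0 := sub_ne_zero.2 fun h => hyb (hσ h).symm
        have := card_filter_affine_ne (b := c y) hne
        simp only [hyb, if_false]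
        omega
    · have := card_chosen_inl T y (a + b * y)
      simp only [hy, if_false] at this ⊢
      omega
  have hA2 : #A + 2 * q ≤ q * q + (#T + 2) + if b ∈ exceptional T then 1 else 0 := by
    have := sum_le_sum fun y (_ : y ∈ univ) => hy y
    rw [hA]
    simp only [sum_add_distrib, sum_const, card_univ, smul_eq_mul, ← hq,
      sum_ite_mem_card, hO, sum_ite_eq', mem_univ, if_true] at this
    linarith
  have hB : #B + (2 + if b ∈ exceptional T then 1 else 0) = q := card_chosen_zero T h0 h1 b
  have hc := (card_le_card hsA).trans card_image_le
  rw [card_disjSum] at hc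
  rw [pow_two] at hn
  omega

/-- The gap `0` stops every nonconstant label function `d + ρ w`; the second gap `w` stops the
constant ones, at `w = d`. -/
theorem exists_gap (d ρ : K) : ∃ w : K, d + ρ * w = 0 ∨ d + ρ * w = secondGap w := by
  by_cases hρ : ρ = 0
  · refine ⟨d, ?_⟩
    by_cases hd : d = 0 <;> simp [hρ, hd, secondGap]
  · exact ⟨-(ρ⁻¹ * d), Or.inl (by rw [mul_neg, mul_inv_cancel_left₀ hρ, add_neg_cancel])⟩

/-- For `d ≠ 0` the equations `d + ρ w = 0` and `d + ρ w = w` have distinct nonzero solutions, as `ρ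
≠ 0, 1`. -/
theorem exists_two_gaps {T : Finset K} (e : K) (hT0 : 0 ∉ T) (hT1 : 1 ∉ T) (d : K) {ρ : K}
    (hρ : ρ ∈ T) : ∃ v w : K, v ≠ w ∧
      (d + ρ * v = 0 ∨ d + ρ * v = secondGap v ∨ (v ∈ exceptional T ∧ d + ρ * v = thirdGap e v)) ∧
      (d + ρ * w = 0 ∨ d + ρ * w = secondGap w ∨
        (w ∈ exceptional T ∧ d + ρ * w = thirdGap e w)) := by
  have hρ0 : ρ ≠ 0 := fun h => hT0 (h ▸ hρ)
  have hρ1 : ρ ≠ 1 := fun h => hT1 (h ▸ hρ)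
  by_cases hd : d = 0
  -- For `d = 0` both solutions collapse to `w = 0`. The third gap `w²` is made for this case: it
  -- equals `ρ w` at `w = ρ ∈ T`.
  · refine ⟨0, ρ, hρ0.symm, Or.inl (by simp [hd]), Or.inr (Or.inr ⟨?_, ?_⟩)⟩
    · simp [exceptional, hρ]
    · simp [thirdGap, hd, hρ0, hρ1]
  · have h1 : 1 - ρ ≠ 0 := sub_ne_zero.2 hρ1.symm
    have e1 : d + ρ * -(ρ⁻¹ * d) = 0 := by
      rw [mul_neg, mul_inv_cancel_left₀ hρ0, add_neg_cancel]
    have hw : (1 - ρ)⁻¹ * d ≠ 0 := mul_ne_zero (inv_ne_zero h1) hd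
    have e2 : d + ρ * ((1 - ρ)⁻¹ * d) = (1 - ρ)⁻¹ * d := by
      have := mul_inv_cancel_left₀ h1 d
      rw [sub_mul, one_mul, sub_eq_iff_eq_add] at this
      exact this.symm
    refine ⟨-(ρ⁻¹ * d), (1 - ρ)⁻¹ * d, fun h => ?_, Or.inl e1, Or.inr (Or.inl ?_)⟩
    · rw [h, e2] at e1
      exact hw e1
    · rw [e2, secondGap, if_neg hw]

/-- The line crosses the segments in `[z]`, giving `t` points there. In the classes `(a, w)` it
crosses `q - 1` segments each if `a ∈ O`; otherwise it runs along segments and loses a whole class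
to a gap. Either way at most `(q - 1) q` points lie outside `[z]`. -/
theorem card_onLineOne_le (σ : K → K) {T : Finset K} {e : K} {n : ℕ}
    (hn : n + Fintype.card K = Fintype.card K ^ 2 + #T) (a d ρ : K)
    (s : Finset (Coord K)) (hs : ∀ p ∈ s, (p.label σ (exceptional T)).Chosen T e)
    (hs' : ∀ p ∈ s, OnLineOne σ a d ρ p) : #s ≤ n := by
  have key : #s ≤ #{w : K | w ≠ 0} * Fintype.card K + #T := by
    by_cases ha : a ∈ exceptional T
    · refine card_le_of_subset_image _ _ (Sum.elim
        (fun x => .inl (a, d + ρ * x.2, x.2, x.1 + σ a * (d + ρ * x.2)))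
        (fun r => .inr (.inr (r, σ a * r + ρ)))) ?_
      intro p hp
      have hp1 := hs p hp
      have hp2 := hs' p hp
      rw [mem_image]
      rcases p with ⟨y, η, w, ω⟩ | ⟨r, w, ω⟩ | ⟨r, z⟩
      · obtain ⟨rfl, rfl⟩ := hp2
        refine ⟨.inl (ω - σ y * (d + ρ * w), w), ?_, by simp⟩
        simp only [Coord.label, Label.Chosen, ha, if_true] at hp1
        simpa using hp1.1
      · exact hp2.elim
      · obtain rfl := hp2
        exact ⟨.inr r, inr_mem_disjSum.2 hp1, rfl⟩
    · obtain ⟨v, hv⟩ := exists_gap d ρ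
      -- In `key`, `#{w | w ≠ 0}` only stands for `q - 1`; here the class to exclude is that of `v`.
      have : #{w : K | w ≠ 0} = #{w : K | w ≠ v} := by
        have h1 := card_filter_ne (0 : K)
        have h2 := card_filter_ne v
        omega
      rw [this]
      refine card_le_of_subset_image _ _ (Sum.elim
        (fun x => .inl (a, d + ρ * x.1, x.1, x.2))
        (fun r => .inr (.inr (r, σ a * r + ρ)))) ?_
      intro p hp
      have hp1 := hs p hp
      have hp2 := hs' p hp
      rw [mem_image]
      rcases p with ⟨y, η, w, ω⟩ | ⟨r, w, ω⟩ | ⟨r, z⟩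
      · obtain ⟨rfl, rfl⟩ := hp2
        refine ⟨.inl (w, ω), ?_, by simp⟩
        simp only [Coord.label, Label.Chosen, ha, if_false, not_false_iff, forall_const] at hp1
        have : w ≠ v := by
          rintro rfl
          tauto
        simpa using this
      · exact hp2.elim
      · obtain rfl := hp2
        exact ⟨.inr r, inr_mem_disjSum.2 hp1, rfl⟩
  have h0 := card_filter_ne (0 : K)
  have : #{w : K | w ≠ 0} * Fintype.card K + Fintype.card K = Fintype.card K ^ 2 := by
    rw [pow_two]; nth_rewrite 3 [← h0]; ring
  omega

/-- The line runs along segments in every class it meets. In `[z]` it gains `q` points exactly when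
`ρ ∈ T`, and two gaps then leave `(q - 2) q + q ≤ n`; otherwise one gap leaves `(q - 1) q ≤ n`. -/
theorem card_onLineZero_le (σ : K → K) {T : Finset K} {e : K} (hT0 : 0 ∉ T) (hT1 : 1 ∉ T) {n : ℕ}
    (hn : n + Fintype.card K = Fintype.card K ^ 2 + #T) (d ρ : K)
    (s : Finset (Coord K)) (hs : ∀ p ∈ s, (p.label σ (exceptional T)).Chosen T e)
    (hs' : ∀ p ∈ s, OnLineZero d ρ p) : #s ≤ n := by
  have key : ∀ (B : Finset K) (C : Finset K),
      (∀ w, w ∉ B → (d + ρ * w = 0 ∨ d + ρ * w = secondGap w ∨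
        (w ∈ exceptional T ∧ d + ρ * w = thirdGap e w))) →
      (ρ ∈ T → C = univ) → #s ≤ #B * Fintype.card K + #C := by
    intro B C hB hC
    refine card_le_of_subset_image _ _ (Sum.elim
      (fun x => .inr (.inl (d + ρ * x.1, x.1, x.2)))
      (fun r => .inr (.inr (ρ, r)))) ?_
    intro p hp
    have hp1 := hs p hp
    have hp2 := hs' p hp
    rw [mem_image]
    rcases p with ⟨y, η, w, ω⟩ | ⟨r, w, ω⟩ | ⟨r, z⟩
    · exact hp2.elim
    · obtain rfl := hp2
      refine ⟨.inl (w, ω), ?_, rfl⟩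
      simp only [Coord.label, Label.Chosen] at hp1
      have : w ∈ B := by
        by_contra h
        have := hB w h
        tauto
      simpa using this
    · obtain rfl := hp2
      exact ⟨.inr z, by simp [hC hp1], rfl⟩
  by_cases hρ : ρ ∈ T
  · obtain ⟨v, w, hvw, hv, hw⟩ := exists_two_gaps e hT0 hT1 d hρ
    have h2 := card_filter_ne_ne hvw
    have := key {x | x ≠ v ∧ x ≠ w} univ (fun x hx => by
      simp only [mem_filter, mem_univ, true_and, not_and_or, not_not] at hx
      rcases hx with rfl | rfl <;> assumption) fun _ => rfl
    rw [card_univ] at this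
    have h3 : #{x : K | x ≠ v ∧ x ≠ w} * Fintype.card K + 2 * Fintype.card K
        = Fintype.card K ^ 2 := by
      rw [pow_two]; nth_rewrite 4 [← h2]; ring
    omega
  · obtain ⟨v, hv⟩ := exists_gap d ρ
    have h2 := card_filter_ne v
    have := key {x | x ≠ v} ∅ (fun x hx => by
      simp only [mem_filter, mem_univ, true_and, not_not] at hx
      subst hx; tauto) fun h => (hρ h).elim
    rw [card_empty] at this
    have h3 : #{x : K | x ≠ v} * Fintype.card K + Fintype.card K
        = Fintype.card K ^ 2 := by
      rw [pow_two]; nth_rewrite 3 [← h2]; ring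
    omega

end Arc

end PHG

namespace PHG

open MulOpposite

/-! ### Structure of a finite chain ring of length two. -/

section Coordinates

/-- Coordinates on a chain ring of length two: the residue map `π`, a section `s` of it, and a
bijection `φ` of the residue field onto the radical, of the form `φ k = θ k`, with the twist `σ`
determined by `r θ = θ σ(r)`. -/
structure ChainCoordinates (R K : Type*) [Ring R] [DivisionRing K] where
  π : R →+* K
  s : K → R
  φ : K →+ R
  σ : K → K
  isUnit_of_ne : ∀ r, π r ≠ 0 → IsUnit r
  ker_eq : ∀ r, π r = 0 ↔ r ∈ Ring.jacobson R
  π_s : ∀ a, π (s a) = a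
  φ_injective : Function.Injective φ
  exists_φ : ∀ r, π r = 0 → ∃ k, φ k = r
  π_φ : ∀ k, π (φ k) = 0
  mul_φ : ∀ r k, r * φ k = φ (σ (π r) * k)
  φ_mul : ∀ k r, φ k * r = φ (k * π r)
  σ_injective : Function.Injective σ

/-- The left chain condition leaves a single maximal left ideal, the radical, so `x` has a left
inverse; by finiteness it is two-sided. -/
theorem _root_.IsChainRingOfLengthTwo.isUnit_of_notMem {R : Type*} [Ring R] [Finite R]
    (hR : IsChainRingOfLengthTwo R) {x : R} (hx : x ∉ Ring.jacobson R) : IsUnit x := by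
  have hn := hR.nontrivial
  have hle : ∀ M : Ideal R, M.IsMaximal → M ≤ Ring.jacobson R := by
    intro M hM
    rw [Ring.jacobson_eq_sInf_isMaximal]
    refine le_sInf fun N hN => ?_
    have hN : N.IsMaximal := hN
    rcases hR.left_chain M N with h | h
    · exact h
    · exact (hN.eq_of_le hM.ne_top h).ge
  have htop : Ideal.span {x} = ⊤ := by
    by_contra h
    obtain ⟨M, hM, hxM⟩ := Ideal.exists_le_maximal _ h
    exact hx (hle M hM (hxM (Ideal.subset_span rfl)))
  have h1 : (1 : R) ∈ Ideal.span {x} := htop ▸ Submodule.mem_top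
  obtain ⟨a, ha⟩ := Ideal.mem_span_singleton'.1 h1
  exact ⟨⟨x, a, mul_eq_one_comm.1 ha, ha⟩, rfl⟩

/-- If instead `xR ⊆ yR`, say `x = y c`, then `c` is a unit, since `x ≠ 0` and the radical squares
to zero. Hence any nonzero `θ` in the radical generates it as a right ideal. -/
theorem _root_.IsChainRingOfLengthTwo.exists_mul_eq {R : Type*} [Ring R] [Finite R]
    (hR : IsChainRingOfLengthTwo R) {x y : R} (hx0 : x ≠ 0)
    (hy : y ∈ Ring.jacobson R) : ∃ c, y = x * c := by
  have mem : ∀ {a b : R}, Submodule.span Rᵐᵒᵖ {a} ≤ Submodule.span Rᵐᵒᵖ {b} → ∃ c, a = b * c := by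
    intro a b h
    obtain ⟨c, hc⟩ := Submodule.mem_span_singleton.1 (h (Submodule.mem_span_singleton_self a))
    exact ⟨c.unop, by rw [← hc, ← op_smul_eq_mul, op_unop]⟩
  rcases hR.right_chain (Submodule.span _ {y}) (Submodule.span _ {x}) with h | h
  · exact mem h
  · obtain ⟨c, hc⟩ := mem h
    have hcu : IsUnit c := hR.isUnit_of_notMem fun hcJ => hx0 (hc.trans (hR.rad_mul_rad y hy c hcJ))
    obtain ⟨u, rfl⟩ := hcu
    exact ⟨↑u⁻¹, by rw [hc, Units.mul_inv_cancel_right]⟩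

theorem exists_chainCoordinates {R : Type*} [Ring R] [Finite R] (hR : IsChainRingOfLengthTwo R) :
    ∃ (_ : DivisionRing (R ⧸ Ring.jacobson R)),
      Nonempty (ChainCoordinates R (R ⧸ Ring.jacobson R)) := by
  have hn := hR.nontrivial
  let J := Ring.jacobson R
  have hJ : J ≠ ⊤ := (Ring.jacobson_lt_top R).ne
  have : Nontrivial (R ⧸ J) := Ideal.Quotient.nontrivial_iff.2 hJ
  let π := Ideal.Quotient.mk J
  have hπ : ∀ r, π r = 0 ↔ r ∈ J := fun r => Ideal.Quotient.eq_zero_iff_mem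
  have hsurj : Function.Surjective π := Ideal.Quotient.mk_surjective
  obtain ⟨θ, hθ, hθ0⟩ := (Submodule.ne_bot_iff _).1 hR.rad_ne_bot
  have hθann : ∀ r, θ * r = 0 ↔ r ∈ J := by
    refine fun r => ⟨fun h => ?_, hR.rad_mul_rad θ hθ r⟩
    by_contra hr
    exact hθ0 ((hR.isUnit_of_notMem hr).mul_left_eq_zero.1 h)
  have hθann' : ∀ r, r * θ = 0 → r ∈ J := by
    intro r h
    by_contra hr
    exact hθ0 ((hR.isUnit_of_notMem hr).mul_right_eq_zero.1 h)
  let φ : R ⧸ J →+ R := QuotientAddGroup.lift J.toAddSubgroup (AddMonoidHom.mulLeft θ)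
    fun r hr => (hθann r).2 hr
  have hφ : ∀ r, φ (π r) = θ * r := fun r => rfl
  have hφinj : Function.Injective φ := by
    rw [injective_iff_map_eq_zero]
    intro a ha
    obtain ⟨r, rfl⟩ := hsurj a
    exact (hπ r).2 ((hθann r).1 ha)
  have hφex : ∀ r, r ∈ J → ∃ k, φ k = r := by
    intro r hr
    obtain ⟨c, rfl⟩ := hR.exists_mul_eq hθ0 hr
    exact ⟨π c, rfl⟩
  let s : R ⧸ J → R := Function.surjInv hsurj
  have hs : ∀ a, π (s a) = a := Function.surjInv_eq hsurj
  have hmem : ∀ r k, r * φ k ∈ J := by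
    intro r k
    obtain ⟨x, rfl⟩ := hsurj k
    rw [hφ]
    exact J.mul_mem_left _ (Ideal.mul_mem_right _ _ hθ)
  choose! ψ hψ using hφex
  have hd : ∀ a : R ⧸ J, IsUnit a ∨ a = 0 := by
    intro a
    obtain ⟨r, rfl⟩ := hsurj a
    by_cases h : r ∈ J
    · exact Or.inr ((hπ r).2 h)
    · exact Or.inl ((hR.isUnit_of_notMem h).map π)
  refine ⟨DivisionRing.ofIsUnitOrEqZero hd, ?_⟩
  let _ := DivisionRing.ofIsUnitOrEqZero hd
  refine ⟨{
    π := π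
    s := s
    φ := φ
    σ := fun a => ψ (s a * θ)
    isUnit_of_ne := fun r hr => hR.isUnit_of_notMem fun h => hr ((hπ r).2 h)
    ker_eq := hπ
    π_s := hs
    φ_injective := hφinj
    exists_φ := fun r hr => ⟨_, hψ r ((hπ r).1 hr)⟩
    π_φ := fun k => (hπ _).2 (by simpa using hmem 1 k)
    mul_φ := ?_
    φ_mul := ?_
    σ_injective := ?_ }⟩
  · intro r k
    obtain ⟨x, rfl⟩ := hsurj k
    -- Left multiplication on `θ` depends only on the residue, so the choice of section is
    -- immaterial.
    have h1 : s (π r) * θ = r * θ := by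
      have : s (π r) - r ∈ J := (hπ _).1 (by rw [map_sub, hs, sub_self])
      have := hR.rad_mul_rad _ this θ hθ
      rwa [sub_mul, sub_eq_zero] at this
    have h2 : φ (ψ (s (π r) * θ)) = s (π r) * θ := hψ _ (J.mul_mem_left _ hθ)
    obtain ⟨c, hc⟩ := hsurj (ψ (s (π r) * θ))
    rw [← hc] at h2 ⊢
    change _ = φ (π c * π x)
    rw [← map_mul, hφ, hφ, ← mul_assoc, ← mul_assoc, ← hφ c, h2, h1]
  · intro k r
    obtain ⟨x, rfl⟩ := hsurj k
    change _ = φ (π x * π r)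
    rw [← map_mul, hφ, hφ, mul_assoc]
  · intro a b hab
    have h : s a * θ = s b * θ := by
      rw [← hψ _ (J.mul_mem_left (s a) hθ), ← hψ _ (J.mul_mem_left (s b) hθ)]
      exact congrArg φ hab
    have := (hπ _).2 (hθann' (s a - s b) (by rw [sub_mul, h, sub_self]))
    rwa [map_sub, hs, hs, sub_eq_zero] at this

end Coordinates

end PHG

namespace PHG

open MulOpposite

/-! ### Free submodules given by generators or by an equation. -/

section Modules

variable {R : Type*} [Ring R]

theorem isFreeOfRank_of_linearIndependent {k : ℕ} {v : Fin k → Fin 3 → R}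
    (hv : LinearIndependent Rᵐᵒᵖ v) {N : Submodule Rᵐᵒᵖ (Fin 3 → R)}
    (hN : Submodule.span Rᵐᵒᵖ (Set.range v) = N) : IsFreeOfRank R k N :=
  hN ▸ ⟨Module.Basis.span hv⟩

theorem mem_span_singleton_iff {v x : Fin 3 → R} :
    x ∈ Submodule.span Rᵐᵒᵖ {v} ↔ ∃ c : R, x = fun i => v i * c := by
  rw [Submodule.mem_span_singleton]
  constructor
  · rintro ⟨c, rfl⟩
    exact ⟨c.unop, rfl⟩
  · rintro ⟨c, rfl⟩
    exact ⟨op c, rfl⟩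

theorem isFreeOfRank_one_span {v : Fin 3 → R} {i : Fin 3} (hi : v i = 1) :
    IsFreeOfRank R 1 (Submodule.span Rᵐᵒᵖ {v}) := by
  refine isFreeOfRank_of_linearIndependent (v := fun _ => v) ?_ (by rw [Set.range_const])
  rw [Fintype.linearIndependent_iff]
  intro g hg j
  have := congrFun hg i
  simp only [Fin.sum_univ_one, Pi.smul_apply, hi, Pi.zero_apply, smul_eq_mul_unop, one_mul] at this
  rw [Subsingleton.elim j 0]
  exact unop_injective this

/-- The submodule with equation `xᵢ = α xⱼ + β xₖ`. -/
def equationSubmodule (i j k : Fin 3) (α β : R) : Submodule Rᵐᵒᵖ (Fin 3 → R) where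
  carrier := {x | x i = α * x j + β * x k}
  add_mem' {x y} hx hy := by
    simp only [Set.mem_ofPred_eq, Pi.add_apply] at *
    rw [hx, hy, mul_add, mul_add]; abel
  zero_mem' := by simp
  smul_mem' c x hx := by
    simp only [Set.mem_ofPred_eq, Pi.smul_apply, smul_eq_mul_unop] at *
    rw [hx, add_mul, mul_assoc, mul_assoc]

theorem mem_equationSubmodule {i j k : Fin 3} {α β : R} {x : Fin 3 → R} :
    x ∈ equationSubmodule i j k α β ↔ x i = α * x j + β * x k := Iff.rfl

theorem isFreeOfRank_two_equationSubmodule {i j k : Fin 3} (hij : i ≠ j) (hik : i ≠ k) (hjk : j ≠ k)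
    (α β : R) : IsFreeOfRank R 2 (equationSubmodule i j k α β) := by
  have hcover : ∀ m : Fin 3, m = i ∨ m = j ∨ m = k := by omega
  let v : Fin 3 → R := fun m => if m = i then α else if m = j then 1 else 0
  let u : Fin 3 → R := fun m => if m = i then β else if m = j then 0 else 1
  refine isFreeOfRank_of_linearIndependent (v := ![v, u]) ?_ ?_
  · rw [LinearIndependent.pair_iff]
    intro c d h
    have hj := congrFun h j
    have hk := congrFun h k
    simp only [Pi.add_apply, Pi.smul_apply, smul_eq_mul_unop, v, u, hij.symm, hik.symm, hjk.symm,
      if_true, if_false, one_mul, zero_mul, add_zero, zero_add, Pi.zero_apply] at hj hk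
    exact ⟨unop_injective hj, unop_injective hk⟩
  · ext x
    rw [Matrix.range_cons, Matrix.range_cons, Matrix.range_empty, Set.union_empty,
      Set.singleton_union, Submodule.mem_span_pair, mem_equationSubmodule]
    constructor
    · rintro ⟨c, d, rfl⟩
      simp [v, u, hij.symm, hik.symm, hjk.symm]
    · intro h
      refine ⟨op (x j), op (x k), funext fun m => ?_⟩
      rcases hcover m with rfl | rfl | rfl
      · simp [v, u, h]
      · simp [v, u, hij.symm]
      · simp [v, u, hik.symm, hjk.symm]

/-- The line with equation `xᵢ = α xⱼ + β xₖ`. -/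
def equationLine {i j k : Fin 3} (hij : i ≠ j) (hik : i ≠ k) (hjk : j ≠ k) (α β : R) : Line R :=
  ⟨equationSubmodule i j k α β, isFreeOfRank_two_equationSubmodule hij hik hjk α β⟩

end Modules

/-! ### Equations of lines by elimination. -/

section Equations

variable {R K : Type*} [Ring R] [DivisionRing K] (C : ChainCoordinates R K)

namespace ChainCoordinates

theorem exists_inv (C : ChainCoordinates R K) {r : R} (hr : C.π r ≠ 0) : ∃ r', r * r' = 1 ∧ r' * r = 1 := by
  obtain ⟨u, rfl⟩ := C.isUnit_of_ne r hr
  exact ⟨↑u⁻¹, u.mul_inv, u.inv_mul⟩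

/-- `v` and `u` generate `L` and are independent modulo the radical. -/
def Generate (L : Set (Fin 3 → R)) (v u : Fin 3 → R) : Prop :=
  (∀ x ∈ L, ∃ c d, ∀ i, x i = v i * c + u i * d) ∧
    ∀ c d, (∀ i, C.π (v i * c + u i * d) = 0) → C.π c = 0 ∧ C.π d = 0

variable {C} {L : Set (Fin 3 → R)} {v u : Fin 3 → R}

theorem Generate.swap (h : C.Generate L v u) : C.Generate L u v := by
  refine ⟨fun x hx => ?_, fun c d hcd => (h.2 d c fun i => ?_).symm⟩
  · obtain ⟨c, d, hcd⟩ := h.1 x hx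
    exact ⟨d, c, fun i => by rw [hcd, add_comm]⟩
  · rw [add_comm]; exact hcd i

theorem Generate.scale (h : C.Generate L v u) {r r' : R} (h1 : r * r' = 1) :
    C.Generate L (fun i => v i * r) u := by
  have hr : C.π r ≠ 0 := fun h0 => by
    have := congrArg C.π h1
    simp [h0] at this
  refine ⟨fun x hx => ?_, fun c d hcd => ?_⟩
  · obtain ⟨c, d, hcd⟩ := h.1 x hx
    exact ⟨r' * c, d, fun i => by rw [hcd, mul_assoc, ← mul_assoc r, h1, one_mul]⟩
  · obtain ⟨h2, h3⟩ := h.2 (r * c) d fun i => by rw [← mul_assoc]; exact hcd i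
    rw [map_mul] at h2
    exact ⟨(mul_eq_zero.1 h2).resolve_left hr, h3⟩

theorem Generate.shear (h : C.Generate L v u) (r : R) :
    C.Generate L v (fun i => u i - v i * r) := by
  refine ⟨fun x hx => ?_, fun c d hcd => ?_⟩
  · obtain ⟨c, d, hcd⟩ := h.1 x hx
    exact ⟨c + r * d, d, fun i => by rw [hcd, mul_add, sub_mul, mul_assoc]; abel⟩
  · obtain ⟨h2, h3⟩ := h.2 (c - r * d) d fun i => by
      rw [← hcd i, mul_sub, sub_mul, mul_assoc]; congr 1; abel
    rw [map_sub, map_mul, h3, mul_zero, sub_zero] at h2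
    exact ⟨h2, h3⟩

theorem Generate.exists_ne_zero (h : C.Generate L v u) : ∃ i, C.π (u i) ≠ 0 := by
  by_contra! h'
  have := (h.2 0 1 fun i => by simp [h' i]).2
  simp at this

/-- The last clause preserves coordinates already in the radical, so that the third equation type
gets radical coefficients. -/
theorem Generate.exists_pivot (h : C.Generate L v u) {i : Fin 3} (hi : C.π (v i) ≠ 0) :
    ∃ v' u', C.Generate L v' u' ∧ v' i = 1 ∧ u' i = 0 ∧
      ∀ j, C.π (v j) = 0 → C.π (u j) = 0 → C.π (v' j) = 0 ∧ C.π (u' j) = 0 := by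
  obtain ⟨r, h1, h2⟩ := C.exists_inv hi
  refine ⟨_, _, (h.scale h2).shear (u i), h1, by simp [h1], fun j hv hu => ?_⟩
  simp [hv, hu]

/-- Gaussian elimination with unit pivots; the pair of pivot columns decides the type. Only
containment in the equation's solution set is needed, as lines are bounded from above. -/
theorem Generate.exists_equation (h : C.Generate L v u) :
    (∃ α β, ∀ x ∈ L, x 2 = α * x 0 + β * x 1) ∨
    (∃ α ρ, C.π ρ = 0 ∧ ∀ x ∈ L, x 1 = α * x 0 + ρ * x 2) ∨
    (∃ δ ρ, C.π δ = 0 ∧ C.π ρ = 0 ∧ ∀ x ∈ L, x 0 = δ * x 1 + ρ * x 2) := by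
  have first : ∀ v u, C.Generate L v u → C.π (v 0) ≠ 0 →
      (∃ α β, ∀ x ∈ L, x 2 = α * x 0 + β * x 1) ∨
      (∃ α ρ, C.π ρ = 0 ∧ ∀ x ∈ L, x 1 = α * x 0 + ρ * x 2) := by
    intro v u h hv
    obtain ⟨v, u, h, hv0, hu0, -⟩ := h.exists_pivot hv
    by_cases hu1 : C.π (u 1) = 0
    · have hu2 : C.π (u 2) ≠ 0 := by
        obtain ⟨i, hi⟩ := h.exists_ne_zero
        fin_cases i
        · simp [hu0] at hi
        · exact (hi hu1).elim
        · exact hi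
      obtain ⟨r, h1, h2⟩ := C.exists_inv hu2
      refine Or.inr ⟨v 1 - u 1 * r * v 2, u 1 * r, by simp [hu1], fun x hx => ?_⟩
      obtain ⟨c, d, hx⟩ := h.1 x hx
      have : u 1 * r * (u 2 * d) = u 1 * d := by
        rw [mul_assoc, ← mul_assoc r, h2, one_mul]
      rw [hx 0, hx 1, hx 2, hv0, hu0, one_mul, zero_mul, add_zero, mul_add, this, sub_mul,
        mul_assoc _ (v 2)]
      abel
    · obtain ⟨r, h1, h2⟩ := C.exists_inv hu1
      refine Or.inl ⟨v 2 - u 2 * r * v 1, u 2 * r, fun x hx => ?_⟩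
      obtain ⟨c, d, hx⟩ := h.1 x hx
      have : u 2 * r * (u 1 * d) = u 2 * d := by
        rw [mul_assoc, ← mul_assoc r, h2, one_mul]
      rw [hx 0, hx 1, hx 2, hv0, hu0, one_mul, zero_mul, add_zero, mul_add, this, sub_mul,
        mul_assoc _ (v 1)]
      abel
  have second : ∀ v u, C.Generate L v u → C.π (v 0) = 0 → C.π (u 0) = 0 → C.π (v 1) ≠ 0 →
      ∃ δ ρ, C.π δ = 0 ∧ C.π ρ = 0 ∧ ∀ x ∈ L, x 0 = δ * x 1 + ρ * x 2 := by
    intro v u h hv0 hu0 hv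
    obtain ⟨v, u, h, hv1, hu1, h0⟩ := h.exists_pivot hv
    obtain ⟨hv0, hu0⟩ := h0 0 hv0 hu0
    have hu2 : C.π (u 2) ≠ 0 := by
      obtain ⟨i, hi⟩ := h.exists_ne_zero
      fin_cases i
      · exact (hi hu0).elim
      · simp [hu1] at hi
      · exact hi
    obtain ⟨r, h1, h2⟩ := C.exists_inv hu2
    refine ⟨v 0 - u 0 * r * v 2, u 0 * r, by simp [hv0, hu0], by simp [hu0], fun x hx => ?_⟩
    obtain ⟨c, d, hx⟩ := h.1 x hx
    have : u 0 * r * (u 2 * d) = u 0 * d := by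
      rw [mul_assoc, ← mul_assoc r, h2, one_mul]
    rw [hx 0, hx 1, hx 2, hv1, hu1, one_mul, zero_mul, add_zero, mul_add, this, sub_mul,
      mul_assoc _ (v 2)]
    abel
  by_cases hv0 : C.π (v 0) = 0
  · by_cases hu0 : C.π (u 0) = 0
    · by_cases hv1 : C.π (v 1) = 0
      · by_cases hu1 : C.π (u 1) = 0
        · have hu2 : C.π (u 2) ≠ 0 := by
            obtain ⟨i, hi⟩ := h.exists_ne_zero
            fin_cases i
            · exact (hi hu0).elim
            · exact (hi hu1).elim
            · exact hi
          obtain ⟨r, h1, h2⟩ := C.exists_inv hu2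
          -- Both vectors are multiples of the last unit vector modulo the radical, hence dependent
          -- there.
          have := (h.2 1 (-(r * v 2)) fun i => by
            fin_cases i
            · simp [hv0, hu0]
            · simp [hv1, hu1]
            · simp [← mul_assoc, h1]).1
          simp at this
        · exact Or.inr (Or.inr (second u v h.swap hu0 hv0 hu1))
      · exact Or.inr (Or.inr (second v u h hv0 hu0 hv1))
    · exact (first u v h.swap hu0).elim Or.inl fun h => Or.inr (Or.inl h)
  · exact (first v u h hv0).elim Or.inl fun h => Or.inr (Or.inl h)

theorem π_eq_zero_of_mul_φ {c : R} (h : c * C.φ 1 = 0) : C.π c = 0 := by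
  by_contra hc
  have := (C.isUnit_of_ne c hc).mul_right_eq_zero.1 h
  exact one_ne_zero ((injective_iff_map_eq_zero C.φ).1 C.φ_injective _ this)

theorem mul_φ_of_π {c : R} (h : C.π c = 0) (k : K) : c * C.φ k = 0 := by
  obtain ⟨a, rfl⟩ := C.exists_φ c h
  rw [C.φ_mul, C.π_φ, mul_zero, map_zero]

-- A relation modulo the radical becomes a true relation after right multiplication by `θ = C.φ 1`.
-- Freeness then gives `c θ = d θ = 0`, which puts `c` and `d` in the radical.
variable (C) in
theorem exists_generate (L : Line R) : ∃ v u, C.Generate (L.1 : Set (Fin 3 → R)) v u := by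
  obtain ⟨b⟩ := L.2
  refine ⟨b 0, b 1, fun x hx => ?_, fun c d h => ?_⟩
  · have := congrArg Subtype.val (b.sum_repr ⟨x, hx⟩)
    rw [Fin.sum_univ_two] at this
    exact ⟨(b.repr ⟨x, hx⟩ 0).unop, (b.repr ⟨x, hx⟩ 1).unop, fun i => (congrFun this i).symm⟩
  · have hb : op (c * C.φ 1) • b 0 + op (d * C.φ 1) • b 1 = 0 := by
      refine Subtype.ext (funext fun i => ?_)
      have := mul_φ_of_π (h i) 1
      rw [add_mul, mul_assoc, mul_assoc] at this
      exact this
    have hli := Fintype.linearIndependent_iff.1 b.linearIndependent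
      ![op (c * C.φ 1), op (d * C.φ 1)] (by simpa [Fin.sum_univ_two] using hb)
    exact ⟨π_eq_zero_of_mul_φ (op_injective (hli 0)), π_eq_zero_of_mul_φ (op_injective (hli 1))⟩

end ChainCoordinates

end Equations

end PHG

namespace PHG

open MulOpposite

/-! ### Points, neighbour classes and lines in coordinates. -/

section Points

variable {R K : Type*} [Ring R] [DivisionRing K] (C : ChainCoordinates R K)

namespace ChainCoordinates

/-- The ring element with the given coordinates. -/
def lift (a b : K) : R := C.s a + C.φ b

theorem π_lift (a b : K) : C.π (C.lift a b) = a := by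
  rw [lift, map_add, C.π_s, C.π_φ, add_zero]

theorem lift_inj {a b a' b' : K} : C.lift a b = C.lift a' b' ↔ a = a' ∧ b = b' := by
  constructor
  · intro h
    have ha : a = a' := by rw [← C.π_lift a b, h, C.π_lift]
    subst ha
    exact ⟨rfl, C.φ_injective (add_left_cancel h)⟩
  · rintro ⟨rfl, rfl⟩
    rfl

theorem exists_lift (x : R) : ∃ b, C.lift (C.π x) b = x := by
  obtain ⟨b, hb⟩ := C.exists_φ (x - C.s (C.π x)) (by rw [map_sub, C.π_s, sub_self])
  exact ⟨b, by rw [lift, hb, add_sub_cancel]⟩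

theorem eq_lift_iff {x : R} {a b : K} :
    x = C.lift a b ↔ C.π x = a ∧ x - C.s a = C.φ b := by
  rw [lift, sub_eq_iff_eq_add']
  constructor
  · intro h
    exact ⟨by rw [h, ← lift, π_lift], h⟩
  · exact fun h => h.2

/-- The representing vector of a point. -/
def vec : Coord K → Fin 3 → R
  | .inl (y, η, w, ω) => ![1, C.lift y η, C.lift w ω]
  | .inr (.inl (r, w, ω)) => ![C.φ r, 1, C.lift w ω]
  | .inr (.inr (r, s)) => ![C.φ r, C.φ s, 1]

theorem exists_vec_eq_one (p : Coord K) : ∃ i, C.vec p i = 1 := by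
  rcases p with ⟨y, η, w, ω⟩ | ⟨r, w, ω⟩ | ⟨r, s⟩
  · exact ⟨0, rfl⟩
  · exact ⟨1, rfl⟩
  · exact ⟨2, rfl⟩

/-- The point with given coordinates. -/
def toPoint (p : Coord K) : Point R :=
  ⟨Submodule.span Rᵐᵒᵖ {C.vec p}, (C.exists_vec_eq_one p).elim fun _ h => isFreeOfRank_one_span h⟩

theorem toPoint_mem_points {p : Coord K} {L : Line R} :
    C.toPoint p ∈ L.points ↔ C.vec p ∈ L.1 :=
  Submodule.span_singleton_le_iff_mem _ _

theorem residueMap_eq_iff {v u : Fin 3 → R} :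
    residueMap R v = residueMap R u ↔ ∀ i, C.π (v i) = C.π (u i) := by
  rw [funext_iff]
  refine forall_congr' fun i => ?_
  rw [residueMap, residueMap, Submodule.Quotient.eq, ← C.ker_eq, map_sub, sub_eq_zero]

theorem π_vec_eq {p p' : Coord K} (h : p.toClass = p'.toClass) (i : Fin 3) :
    C.π (C.vec p i) = C.π (C.vec p' i) := by
  rcases p with ⟨y, η, w, ω⟩ | ⟨r, w, ω⟩ | ⟨r, s⟩ <;>
  rcases p' with ⟨y', η', w', ω'⟩ | ⟨r', w', ω'⟩ | ⟨r', s'⟩ <;>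
  simp only [Coord.toClass, Sum.inl.injEq, Sum.inr.injEq, Prod.mk.injEq, reduceCtorEq] at h
  all_goals fin_cases i <;> simp [vec, π_lift, π_φ, h]

theorem toClass_eq_of_π_vec {p p' : Coord K} {k : K}
    (h : ∀ i, C.π (C.vec p i) = C.π (C.vec p' i) * k) : p.toClass = p'.toClass := by
  have h0 := h 0
  have h1 := h 1
  have h2 := h 2
  rcases p with ⟨y, η, w, ω⟩ | ⟨r, w, ω⟩ | ⟨r, s⟩ <;>
  rcases p' with ⟨y', η', w', ω'⟩ | ⟨r', w', ω'⟩ | ⟨r', s'⟩ <;>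
  simp [vec, π_lift, π_φ] at h0 h1 h2
  all_goals try subst h0
  all_goals try subst h1
  all_goals simp_all [Coord.toClass]

theorem neighbour_toPoint_iff {p p' : Coord K} :
    Neighbour (C.toPoint p) (C.toPoint p') ↔ p.toClass = p'.toClass := by
  constructor
  · intro h
    have hp : residueMap R (C.vec p) ∈ residueMap R '' ((C.toPoint p).1 : Set (Fin 3 → R)) :=
      ⟨_, Submodule.mem_span_singleton_self _, rfl⟩
    rw [h] at hp
    obtain ⟨x, hx, hxp⟩ := hp
    obtain ⟨c, rfl⟩ := mem_span_singleton_iff.1 hx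
    refine C.toClass_eq_of_π_vec (k := C.π c) fun i => ?_
    rw [← map_mul]
    exact (C.residueMap_eq_iff.1 hxp i).symm
  · have key : ∀ p p' : Coord K, p.toClass = p'.toClass →
        residueMap R '' ((C.toPoint p).1 : Set (Fin 3 → R)) ⊆
          residueMap R '' ((C.toPoint p').1 : Set (Fin 3 → R)) := by
      rintro p p' h _ ⟨x, hx, rfl⟩
      obtain ⟨c, rfl⟩ := mem_span_singleton_iff.1 hx
      refine ⟨fun i => C.vec p' i * c, mem_span_singleton_iff.2 ⟨c, rfl⟩, ?_⟩
      rw [C.residueMap_eq_iff]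
      intro i
      rw [map_mul, map_mul, C.π_vec_eq h]
    exact fun h => (key _ _ h).antisymm (key _ _ h.symm)

/-- Equal points lie in the same class, so both vectors have their entry `1` in the same position
and the scalar between them is `1`. -/
theorem toPoint_injective : Function.Injective C.toPoint := by
  intro p p' h
  have hc : p.toClass = p'.toClass := C.neighbour_toPoint_iff.1 (by rw [h]; exact rfl)
  have hv : C.vec p ∈ (C.toPoint p').1 := h ▸ Submodule.mem_span_singleton_self _
  obtain ⟨c, hv⟩ := mem_span_singleton_iff.1 hv
  have hc1 : c = 1 → C.vec p = C.vec p' := by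
    rintro rfl
    simpa using hv
  have h0 := congrFun hv 0
  have h1 := congrFun hv 1
  have h2 := congrFun hv 2
  rcases p with ⟨y, η, w, ω⟩ | ⟨r, w, ω⟩ | ⟨r, s⟩ <;>
  rcases p' with ⟨y', η', w', ω'⟩ | ⟨r', w', ω'⟩ | ⟨r', s'⟩ <;>
  simp only [Coord.toClass, Sum.inl.injEq, Sum.inr.injEq, Prod.mk.injEq, reduceCtorEq] at hc
  · have := hc1 (by simpa [vec] using h0.symm)
    have e1 := congrFun this 1
    have e2 := congrFun this 2
    simp [vec, lift_inj] at e1 e2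
    simp [e1, e2]
  · have := hc1 (by simpa [vec] using h1.symm)
    have e1 := congrFun this 0
    have e2 := congrFun this 2
    simp [vec, lift_inj, C.φ_injective.eq_iff] at e1 e2
    simp [e1, e2]
  · have := hc1 (by simpa [vec] using h2.symm)
    have e1 := congrFun this 0
    have e2 := congrFun this 1
    simp [vec, C.φ_injective.eq_iff] at e1 e2
    simp [e1, e2]

theorem exists_vec_eq {v : Fin 3 → R} (hv : ∃ i, C.π (v i) ≠ 0) :
    ∃ p r r', r * r' = 1 ∧ C.vec p = fun i => v i * r := by
  by_cases h0 : C.π (v 0) = 0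
  · by_cases h1 : C.π (v 1) = 0
    · have h2 : C.π (v 2) ≠ 0 := by
        obtain ⟨i, hi⟩ := hv
        fin_cases i
        · exact (hi h0).elim
        · exact (hi h1).elim
        · exact hi
      obtain ⟨r, hr, hr'⟩ := C.exists_inv h2
      obtain ⟨a, ha⟩ := C.exists_φ (v 0 * r) (by simp [h0])
      obtain ⟨b, hb⟩ := C.exists_φ (v 1 * r) (by simp [h1])
      refine ⟨.inr (.inr (a, b)), r, _, hr', funext fun i => ?_⟩
      fin_cases i <;> simp [vec, ha, hb, hr]
    · obtain ⟨r, hr, hr'⟩ := C.exists_inv h1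
      obtain ⟨a, ha⟩ := C.exists_φ (v 0 * r) (by simp [h0])
      obtain ⟨b, hb⟩ := C.exists_lift (v 2 * r)
      refine ⟨.inr (.inl (a, C.π (v 2 * r), b)), r, _, hr', funext fun i => ?_⟩
      fin_cases i
      · exact ha
      · exact hr.symm
      · exact hb
  · obtain ⟨r, hr, hr'⟩ := C.exists_inv h0
    obtain ⟨a, ha⟩ := C.exists_lift (v 1 * r)
    obtain ⟨b, hb⟩ := C.exists_lift (v 2 * r)
    refine ⟨.inl (C.π (v 1 * r), a, C.π (v 2 * r), b), r, _, hr', funext fun i => ?_⟩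
    fin_cases i
    · exact hr.symm
    · exact ha
    · exact hb

theorem toPoint_surjective : Function.Surjective C.toPoint := by
  rintro ⟨N, ⟨b⟩⟩
  have hb : ∃ i, C.π ((b 0 : Fin 3 → R) i) ≠ 0 := by
    by_contra! h
    have h0 : op (C.φ 1) • b 0 = 0 := Subtype.ext (funext fun i => mul_φ_of_π (h i) 1)
    have := Fintype.linearIndependent_iff.1 b.linearIndependent
      (fun _ => op (C.φ 1)) (by simpa using h0) 0
    have h1 : C.φ 1 = 0 := op_injective this
    exact one_ne_zero ((injective_iff_map_eq_zero C.φ).1 C.φ_injective _ h1)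
  obtain ⟨p, r, r', hr, hp⟩ := C.exists_vec_eq hb
  refine ⟨p, Subtype.ext (le_antisymm ?_ fun x hx => ?_)⟩
  · refine (Submodule.span_singleton_le_iff_mem _ _).2 ?_
    rw [hp]
    exact N.smul_mem (op r) (b 0).2
  · refine mem_span_singleton_iff.2 ?_
    have := congrArg Subtype.val (b.sum_repr ⟨x, hx⟩)
    rw [Fin.sum_univ_one] at this
    refine ⟨r' * (b.repr ⟨x, hx⟩ 0).unop, funext fun i => ?_⟩
    rw [hp, mul_assoc, ← mul_assoc r, hr, one_mul]
    exact (congrFun this i).symm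

theorem exists_onLineTwo (α β : R) : ∃ a b d c, ∀ p,
    C.vec p 2 = α * C.vec p 0 + β * C.vec p 1 → OnLineTwo C.σ a b d c p := by
  -- The section `s` need not respect sums and products; the function `c` collects the resulting
  -- carry for each `y`.
  have hc : ∀ y, ∃ k, C.φ k = α + β * C.s y - C.s (C.π α + C.π β * y) := fun y =>
    C.exists_φ _ (by simp [C.π_s])
  obtain ⟨d, hd⟩ := C.exists_φ (β - C.s (C.π β)) (by simp [C.π_s])
  choose c hc using hc
  refine ⟨C.π α, C.π β, d, c, ?_⟩
  rintro (⟨y, η, w, ω⟩ | ⟨r, w, ω⟩ | ⟨r, s⟩) h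
  · obtain ⟨rfl, h⟩ := C.eq_lift_iff.1 (show α * 1 + β * C.lift y η = C.lift w ω from h.symm)
    have hw : C.π (α * 1 + β * C.lift y η) = C.π α + C.π β * y := by simp [π_lift]
    refine ⟨hw, C.φ_injective ?_⟩
    rw [← h, hw, map_add, hc, ← C.mul_φ, lift, mul_add, mul_one]
    abel
  · obtain ⟨rfl, h⟩ := C.eq_lift_iff.1 (show α * C.φ r + β * 1 = C.lift w ω from h.symm)
    have hw : C.π (α * C.φ r + β * 1) = C.π β := by simp [π_φ]
    refine ⟨hw, C.φ_injective ?_⟩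
    rw [← h, hw, map_add, hd, ← C.mul_φ, mul_one]
    abel
  · have := congrArg C.π (show 1 = α * C.φ r + β * C.φ s from h)
    simp [π_φ] at this

theorem exists_onLineOne (α : R) {ρ : R} (hρ : C.π ρ = 0) : ∃ a d k, ∀ p,
    C.vec p 1 = α * C.vec p 0 + ρ * C.vec p 2 → OnLineOne C.σ a d k p := by
  obtain ⟨d, hd⟩ := C.exists_lift α
  obtain ⟨k, rfl⟩ := C.exists_φ ρ hρ
  refine ⟨C.π α, d, k, ?_⟩
  rintro (⟨y, η, w, ω⟩ | ⟨r, w, ω⟩ | ⟨r, s⟩) h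
  · have h : C.lift y η = α * 1 + C.φ k * C.lift w ω := h
    rw [C.φ_mul, π_lift, mul_one, ← hd, lift, lift, add_assoc, ← map_add, ← lift, ← lift,
      lift_inj] at h
    exact h
  · have := congrArg C.π (show 1 = α * C.φ r + C.φ k * C.lift w ω from h)
    simp [π_φ] at this
  · have h : C.φ s = α * C.φ r + C.φ k * 1 := h
    rw [mul_one, C.mul_φ, ← map_add] at h
    exact C.φ_injective h

theorem exists_onLineZero {δ ρ : R} (hδ : C.π δ = 0) (hρ : C.π ρ = 0) : ∃ d k, ∀ p,
    C.vec p 0 = δ * C.vec p 1 + ρ * C.vec p 2 → OnLineZero d k p := by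
  obtain ⟨d, rfl⟩ := C.exists_φ δ hδ
  obtain ⟨k, rfl⟩ := C.exists_φ ρ hρ
  refine ⟨d, k, ?_⟩
  rintro (⟨y, η, w, ω⟩ | ⟨r, w, ω⟩ | ⟨r, s⟩) h
  · have := congrArg C.π (show 1 = C.φ d * C.lift y η + C.φ k * C.lift w ω from h)
    simp [π_φ] at this
  · have h : C.φ r = C.φ d * 1 + C.φ k * C.lift w ω := h
    rw [C.φ_mul k, π_lift, mul_one, ← map_add] at h
    exact C.φ_injective h
  · have h : C.φ r = C.φ d * C.φ s + C.φ k * 1 := h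
    rw [mul_one, C.φ_mul, π_φ, mul_zero, map_zero, zero_add] at h
    exact C.φ_injective h

theorem exists_line_label [DecidableEq K] (O : Finset K) (l : Label K) :
    ∃ L : Line R, ∀ p : Coord K, p.toClass = l.toClass →
      (C.toPoint p ∈ L.points ↔ p.label C.σ O = l) := by
  rcases l with ⟨y, w, τ⟩ | ⟨w, r⟩ | r
  · by_cases hy : y ∈ O
    -- The slope `s y` gives the direction `y`; subtracting `s y * s y` makes the line pass through
    -- `(1, s y, lift w τ)`.
    · refine ⟨equationLine (i := 2) (j := 0) (k := 1) (by decide) (by decide) (by decide)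
        (C.lift w τ - C.s y * C.s y) (C.s y), ?_⟩
      rintro (⟨y', η, w', ω⟩ | ⟨r', w', ω⟩ | ⟨r', s⟩) h <;>
      simp only [Coord.toClass, Label.toClass, Sum.inl.injEq, Prod.mk.injEq, reduceCtorEq] at h
      obtain ⟨rfl, rfl⟩ := h
      rw [toPoint_mem_points]
      change C.lift w' ω = (C.lift w' τ - C.s y' * C.s y') * 1 + C.s y' * C.lift y' η ↔ _
      have e : (C.lift w' τ - C.s y' * C.s y') * 1 + C.s y' * C.lift y' η =
          C.lift w' (τ + C.σ y' * η) := by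
        rw [lift, lift, lift, mul_one, mul_add, C.mul_φ, C.π_s, map_add]; abel
      rw [e, lift_inj]
      simp [Coord.label, hy, sub_eq_iff_eq_add]
    · refine ⟨equationLine (i := 1) (j := 0) (k := 2) (by decide) (by decide) (by decide)
        (C.lift y τ) 0, ?_⟩
      rintro (⟨y', η, w', ω⟩ | ⟨r', w', ω⟩ | ⟨r', s⟩) h <;>
      simp only [Coord.toClass, Label.toClass, Sum.inl.injEq, Prod.mk.injEq, reduceCtorEq] at h
      obtain ⟨rfl, rfl⟩ := h
      rw [toPoint_mem_points]
      change C.lift y' η = C.lift y' τ * 1 + 0 * C.lift w' ω ↔ _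
      rw [mul_one, zero_mul, add_zero, lift_inj]
      simp [Coord.label, hy]
  · refine ⟨equationLine (i := 0) (j := 1) (k := 2) (by decide) (by decide) (by decide)
      (C.φ r) 0, ?_⟩
    rintro (⟨y', η, w', ω⟩ | ⟨r', w', ω⟩ | ⟨r', s⟩) h <;>
    simp only [Coord.toClass, Label.toClass, Sum.inl.injEq, Sum.inr.injEq, reduceCtorEq] at h
    obtain rfl := h
    rw [toPoint_mem_points]
    change C.φ r' = C.φ r * 1 + 0 * C.lift w' ω ↔ _
    rw [mul_one, zero_mul, add_zero, C.φ_injective.eq_iff]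
    simp [Coord.label]
  · refine ⟨equationLine (i := 0) (j := 1) (k := 2) (by decide) (by decide) (by decide)
      0 (C.φ r), ?_⟩
    rintro (⟨y', η, w', ω⟩ | ⟨r', w', ω⟩ | ⟨r', s⟩) h <;>
    simp only [Coord.toClass, Label.toClass, Sum.inr.injEq, reduceCtorEq] at h
    rw [toPoint_mem_points]
    change C.φ r' = 0 * C.φ s + C.φ r * 1 ↔ _
    rw [mul_one, zero_mul, zero_add, C.φ_injective.eq_iff]
    simp [Coord.label]

end ChainCoordinates

end Points

end PHG

namespace PHG

/-! ### From labels over `K` to segments and arcs in the plane. -/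

section Transfer

open Finset

variable {R K : Type*} [Ring R] [DivisionRing K] [DecidableEq K] (C : ChainCoordinates R K)
  (O : Finset K)

theorem Label.toClass_param (σ : K → K) (l : Label K) (k : K) :
    (l.param σ O k).toClass = l.toClass := by
  have h := (Coord.label_eq_iff σ O _ l).2 ⟨k, rfl⟩
  rw [← Coord.toClass_label σ O, h]

/-- The line segment with a given label. -/
def segment (l : Label K) : Set (Point R) := C.toPoint '' {p | p.label C.σ O = l}

theorem param_mem_segment (l : Label K) (k : K) : C.toPoint (l.param C.σ O k) ∈ segment C O l :=
  ⟨_, (Coord.label_eq_iff _ _ _ _).2 ⟨k, rfl⟩, rfl⟩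

theorem toPoint_mem_segment {p : Coord K} {l : Label K} :
    C.toPoint p ∈ segment C O l ↔ p.label C.σ O = l :=
  C.toPoint_injective.mem_set_image

theorem isLineSegment_segment (l : Label K) : IsLineSegment (segment C O l) := by
  refine ⟨⟨_, param_mem_segment C O l 0⟩, ?_⟩
  obtain ⟨L, hL⟩ := C.exists_line_label O l
  refine ⟨L, C.toPoint (l.param C.σ O 0), Set.ext fun x => ?_⟩
  obtain ⟨p, rfl⟩ := C.toPoint_surjective x
  have h : C.toPoint p ∈ pointClass (C.toPoint (l.param C.σ O 0)) ↔ p.toClass = l.toClass := by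
    rw [← Label.toClass_param O C.σ l 0]
    exact C.neighbour_toPoint_iff
  rw [toPoint_mem_segment, Set.mem_inter_iff, h]
  constructor
  · rintro rfl
    have := (Coord.toClass_label C.σ O p).symm
    exact ⟨(hL p this).2 rfl, this⟩
  · exact fun ⟨h1, h2⟩ => (hL p h2).1 h1

theorem segment_subset_pointClass_iff {l : Label K} {z : Coord K} :
    segment C O l ⊆ pointClass (C.toPoint z) ↔ l.toClass = z.toClass := by
  constructor
  · intro h
    rw [← Label.toClass_param O C.σ l 0]
    exact C.neighbour_toPoint_iff.1 (h (param_mem_segment C O l 0))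
  · rintro h _ ⟨p, rfl, rfl⟩
    rw [Coord.toClass_label] at h
    exact C.neighbour_toPoint_iff.2 h

theorem disjoint_segment {l l' : Label K} (h : l ≠ l') :
    Disjoint (segment C O l) (segment C O l') := by
  rw [Set.disjoint_left]
  rintro _ ⟨p, rfl, rfl⟩ h'
  exact h ((toPoint_mem_segment C O).1 h')

theorem segment_injective : Function.Injective (segment C O) := by
  intro l l' h
  by_contra hne
  exact (disjoint_segment C O hne).ne_of_mem (param_mem_segment C O l 0)
    (h ▸ param_mem_segment C O l 0) rfl

theorem ncard_segments_subset_pointClass (P : Label K → Prop) (z : Coord K) :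
    {S ∈ segment C O '' {l | P l} | S ⊆ pointClass (C.toPoint z)}.ncard =
      {l | P l ∧ l.toClass = z.toClass}.ncard := by
  rw [← Set.ncard_image_of_injective _ (segment_injective C O)]
  congr 1
  ext S
  constructor
  · rintro ⟨⟨l, hl, rfl⟩, h⟩
    exact ⟨l, ⟨hl, (segment_subset_pointClass_iff C O).1 h⟩, rfl⟩
  · rintro ⟨l, ⟨hl, h⟩, rfl⟩
    exact ⟨⟨l, hl, rfl⟩, (segment_subset_pointClass_iff C O).2 h⟩

variable [Fintype K]

theorem card_filter_label (σ : K → K) (l : Label K) :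
    #{p : Coord K | p.label σ O = l} = Fintype.card K := by
  rw [← card_univ, ← card_image_of_injective univ (Label.param_injective σ O l)]
  congr 1
  ext p
  simp [Coord.label_eq_iff]

theorem ncard_setOf_eq {α : Type*} [Fintype α] (P : α → Prop) [DecidablePred P] :
    {x | P x}.ncard = #{x | P x} := by
  rw [← Set.ncard_coe_finset]
  congr 1
  ext; simp

/-- A union of segments given by coordinates is an arc if it satisfies the bound for all
three types of line equations. -/
theorem isArc_of_labels (P : Label K → Prop) [DecidablePred P] {n : ℕ}
    (hTwo : ∀ a b d c (s : Finset (Coord K)), (∀ p ∈ s, P (p.label C.σ O)) →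
      (∀ p ∈ s, OnLineTwo C.σ a b d c p) → #s ≤ n)
    (hOne : ∀ a d ρ (s : Finset (Coord K)), (∀ p ∈ s, P (p.label C.σ O)) →
      (∀ p ∈ s, OnLineOne C.σ a d ρ p) → #s ≤ n)
    (hZero : ∀ d ρ (s : Finset (Coord K)), (∀ p ∈ s, P (p.label C.σ O)) →
      (∀ p ∈ s, OnLineZero d ρ p) → #s ≤ n) :
    IsArc (⋃₀ (segment C O '' {l | P l})) (Fintype.card K * #{l | P l}) n := by
  classical
  have hK : ⋃₀ (segment C O '' {l | P l}) = C.toPoint '' {p | P (p.label C.σ O)} := by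
    ext x
    obtain ⟨p, rfl⟩ := C.toPoint_surjective x
    rw [C.toPoint_injective.mem_set_image, Set.sUnion_image]
    simp [toPoint_mem_segment]
  refine ⟨?_, fun L => ?_⟩
  · rw [hK, Set.ncard_image_of_injective _ C.toPoint_injective, ncard_setOf_eq,
      card_eq_sum_card_fiberwise (f := Coord.label C.σ O) (t := {l | P l})
        (fun p hp => by simpa using hp), mul_comm, ← smul_eq_mul, ← sum_const]
    refine sum_congr rfl fun l hl => ?_
    rw [← card_filter_label O C.σ l]
    congr 1
    ext p
    simp only [mem_filter, mem_univ, true_and] at hl ⊢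
    constructor
    · exact fun h => h.2
    · rintro rfl
      exact ⟨hl, rfl⟩
  · have hKL : C.toPoint '' {p | P (p.label C.σ O)} ∩ L.points =
        C.toPoint '' {p | P (p.label C.σ O) ∧ C.vec p ∈ L.1} := by
      ext x
      obtain ⟨p, rfl⟩ := C.toPoint_surjective x
      rw [Set.mem_inter_iff, C.toPoint_injective.mem_set_image, C.toPoint_injective.mem_set_image,
        C.toPoint_mem_points]
      rfl
    rw [hK, hKL, Set.ncard_image_of_injective _ C.toPoint_injective, ncard_setOf_eq]
    obtain ⟨v, u, h⟩ := C.exists_generate L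
    rcases h.exists_equation with ⟨α, β, h⟩ | ⟨α, ρ, hρ, h⟩ | ⟨δ, ρ, hδ, hρ, h⟩
    · obtain ⟨a, b, d, c, h'⟩ := C.exists_onLineTwo α β
      refine hTwo a b d c _ ?_ ?_ <;> intro p hp <;>
        simp only [mem_filter, mem_univ, true_and] at hp
      · exact hp.1
      · exact h' p (h _ hp.2)
    · obtain ⟨a, d, k, h'⟩ := C.exists_onLineOne α hρ
      refine hOne a d k _ ?_ ?_ <;> intro p hp <;>
        simp only [mem_filter, mem_univ, true_and] at hp
      · exact hp.1
      · exact h' p (h _ hp.2)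
    · obtain ⟨d, k, h'⟩ := C.exists_onLineZero hδ hρ
      refine hZero d k _ ?_ ?_ <;> intro p hp <;>
        simp only [mem_filter, mem_univ, true_and] at hp
      · exact hp.1
      · exact h' p (h _ hp.2)

theorem exists_arc_of_labels (P : Label K → Prop) [DecidablePred P] {q n t : ℕ}
    (hq : q = Fintype.card K)
    (hTwo : ∀ a b d c (s : Finset (Coord K)), (∀ p ∈ s, P (p.label C.σ O)) →
      (∀ p ∈ s, OnLineTwo C.σ a b d c p) → #s ≤ n)
    (hOne : ∀ a d ρ (s : Finset (Coord K)), (∀ p ∈ s, P (p.label C.σ O)) →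
      (∀ p ∈ s, OnLineOne C.σ a d ρ p) → #s ≤ n)
    (hZero : ∀ d ρ (s : Finset (Coord K)), (∀ p ∈ s, P (p.label C.σ O)) →
      (∀ p ∈ s, OnLineZero d ρ p) → #s ≤ n)
    (hcard : #{l | P l} + 2 = q * n)
    (hinl : ∀ y w, q ≤ #{τ | P (.inl (y, w, τ))} + 3 ∧ #{τ | P (.inl (y, w, τ))} + 1 ≤ q)
    (hinr : ∀ w, q ≤ #{r | P (.inr (.inl (w, r)))} + 3 ∧ #{r | P (.inr (.inl (w, r)))} + 1 ≤ q)
    (hz : #{r | P (.inr (.inr r))} = t) :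
    ∃ X : Set (Point R),
      IsArc X (q ^ 2 * n - 2 * q) n ∧
      ∃ 𝓢 : Set (Set (Point R)),
        (∀ S ∈ 𝓢, IsLineSegment S) ∧ 𝓢.PairwiseDisjoint id ∧
        𝓢.ncard = q * n - 2 ∧ X = ⋃₀ 𝓢 ∧
        ∃ z : Point R,
          {S ∈ 𝓢 | S ⊆ pointClass z}.ncard = t ∧
          ∀ x : Point R, ¬ Neighbour x z →
            q ≤ {S ∈ 𝓢 | S ⊆ pointClass x}.ncard + 3 ∧
            {S ∈ 𝓢 | S ⊆ pointClass x}.ncard + 1 ≤ q := by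
  have count : ∀ (c : ClassCoord K) (f : K → Label K), Function.Injective f →
      (∀ l : Label K, l.toClass = c ↔ ∃ k, f k = l) →
      {l | P l ∧ l.toClass = c}.ncard = #{k | P (f k)} := by
    intro c f hf hc
    rw [← ncard_setOf_eq, ← Set.ncard_image_of_injective _ hf]
    congr 1
    ext l
    constructor
    · rintro ⟨h, h'⟩
      obtain ⟨k, rfl⟩ := (hc l).1 h'
      exact ⟨k, h, rfl⟩
    · rintro ⟨k, h, rfl⟩
      exact ⟨h, (hc _).2 ⟨k, rfl⟩⟩
  have hN : q * #{l | P l} = q ^ 2 * n - 2 * q := by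
    have : q * (#{l | P l} + 2) = q * (q * n) := by rw [hcard]
    have e : q * (q * n) = q ^ 2 * n := by ring
    rw [← e, ← this, mul_add, mul_comm 2 q, Nat.add_sub_cancel]
  refine ⟨_, hN ▸ hq ▸ isArc_of_labels C O P hTwo hOne hZero, _, ?_, ?_, ?_, rfl,
    C.toPoint (.inr (.inr (0, 0))), ?_, ?_⟩
  · rintro _ ⟨l, -, rfl⟩
    exact isLineSegment_segment C O l
  · rintro _ ⟨l, -, rfl⟩ _ ⟨l', -, rfl⟩ h
    exact disjoint_segment C O fun e => h (e ▸ rfl)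
  · rw [Set.ncard_image_of_injective _ (segment_injective C O), ncard_setOf_eq]
    omega
  · rw [ncard_segments_subset_pointClass, ← hz]
    refine count _ (fun r => .inr (.inr r)) (fun _ _ h => by simpa using h) ?_
    rintro (⟨y, w, τ⟩ | ⟨w, r⟩ | r) <;> simp [Label.toClass, Coord.toClass]
  · intro x hx
    obtain ⟨p, rfl⟩ := C.toPoint_surjective x
    rw [C.neighbour_toPoint_iff] at hx
    rw [ncard_segments_subset_pointClass]
    rcases p with ⟨y, η, w, ω⟩ | ⟨r, w, ω⟩ | ⟨r, s⟩
    · rw [count _ (fun τ => .inl (y, w, τ)) (fun _ _ h => by simpa using h)]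
      · exact hinl y w
      · rintro (⟨y, w, τ⟩ | ⟨w, r⟩ | r) <;> simp [Label.toClass, Coord.toClass, eq_comm]
    · rw [count _ (fun r => .inr (.inl (w, r))) (fun _ _ h => by simpa using h)]
      · exact hinr w
      · rintro (⟨y, w, τ⟩ | ⟨w, r⟩ | r) <;> simp [Label.toClass, Coord.toClass, eq_comm]
    · exact (hx rfl).elim

/-- The two segments of the arc over a residue field of order two. -/
def Label.InPair : Label K → Prop
  | .inl (y, _, τ) => y = 0 ∧ τ ≠ 0
  | .inr _ => False

instance : DecidablePred (Label.InPair : Label K → Prop)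
  | .inl (y, _, τ) => inferInstanceAs (Decidable (y = 0 ∧ τ ≠ 0))
  | .inr _ => inferInstanceAs (Decidable False)

/-- All chosen segments lie in classes with `y = 0`, and such a line meets only one of these. -/
theorem card_inPair_onLineTwo_le (σ : K → K) (a b d : K) (c : K → K) (s : Finset (Coord K))
    (hs : ∀ p ∈ s, (p.label σ O).InPair) (hs' : ∀ p ∈ s, OnLineTwo σ a b d c p) :
    #s ≤ Fintype.card K := by
  have : s ⊆ univ.image fun η => .inl (0, η, a + b * 0, σ b * η + c 0) := by
    intro p hp
    have hp1 := hs p hp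
    have hp2 := hs' p hp
    rcases p with ⟨y, η, w, ω⟩ | ⟨r, w, ω⟩ | ⟨r, z⟩
    · obtain ⟨rfl, -⟩ := hp1
      obtain ⟨rfl, rfl⟩ := hp2
      exact mem_image_of_mem _ (mem_univ η)
    · exact hp1.elim
    · exact hp1.elim
  exact (card_le_card this).trans (card_image_le.trans_eq card_univ)

theorem card_inPair_onLineOne_le (σ : K → K) (hO : 0 ∈ O) (a d ρ : K) (s : Finset (Coord K))
    (hs : ∀ p ∈ s, (p.label σ O).InPair) (hs' : ∀ p ∈ s, OnLineOne σ a d ρ p) :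
    #s ≤ #{τ : K | τ ≠ 0} * Fintype.card K := by
  refine card_le_of_subset_image _ ∅ (Sum.elim
    (fun x => .inl (a, d + ρ * x.2, x.2, x.1 + σ a * (d + ρ * x.2)))
    -- A dummy value, since `C = ∅`.
    (fun r => .inr (.inr (r, r)))) ?_
  intro p hp
  have hp1 := hs p hp
  have hp2 := hs' p hp
  rw [mem_image]
  rcases p with ⟨y, η, w, ω⟩ | ⟨r, w, ω⟩ | ⟨r, z⟩
  · obtain ⟨rfl, hp1⟩ := hp1
    obtain ⟨rfl, rfl⟩ := hp2
    rw [if_pos hO] at hp1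
    refine ⟨.inl (ω - σ 0 * (d + ρ * w), w), ?_, by simp⟩
    simpa using hp1
  · exact hp1.elim
  · exact hp1.elim

theorem card_inPair : #{l : Label K | l.InPair} = Fintype.card K * #{τ : K | τ ≠ 0} := by
  have : ({l : Label K | l.InPair} : Finset _) =
      ((univ : Finset K) ×ˢ ({τ : K | τ ≠ 0} : Finset K)).image fun x => .inl (0, x.1, x.2) := by
    ext l
    rw [mem_filter, mem_image]
    constructor
    · rintro ⟨-, h⟩
      rcases l with ⟨y, w, τ⟩ | l
      · obtain ⟨rfl, h⟩ := h
        exact ⟨(w, τ), by simpa using h, rfl⟩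
      · exact h.elim
    · rintro ⟨⟨w, τ⟩, h, rfl⟩
      refine ⟨mem_univ _, rfl, by simpa using h⟩
  rw [this, card_image_of_injective, card_product, card_univ]
  rintro ⟨w, τ⟩ ⟨w', τ'⟩ h
  simpa using h

/-- The arc of the main theorem, as a union of line segments. -/
theorem ChainCoordinates.exists_arc (C : ChainCoordinates R K) {q n t : ℕ} (hq : q = Fintype.card K)
    (hn : n + q = q ^ 2 + t) (htq : t + 2 ≤ q) :
    ∃ X : Set (Point R),
      IsArc X (q ^ 2 * n - 2 * q) n ∧
      ∃ 𝓢 : Set (Set (Point R)),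
        (∀ S ∈ 𝓢, IsLineSegment S) ∧ 𝓢.PairwiseDisjoint id ∧
        𝓢.ncard = q * n - 2 ∧ X = ⋃₀ 𝓢 ∧
        ∃ z : Point R,
          {S ∈ 𝓢 | S ⊆ pointClass z}.ncard = t ∧
          ∀ x : Point R, ¬ Neighbour x z →
            q ≤ {S ∈ 𝓢 | S ⊆ pointClass x}.ncard + 3 ∧
            {S ∈ 𝓢 | S ⊆ pointClass x}.ncard + 1 ≤ q := by
  have hc := card_filter_ne (0 : K)
  rw [← hq] at hc
  -- The value `e` of the third gap must differ from `0` and `1`, which requires `q > 2`.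
  by_cases hq2 : q = 2
  · have ht : t = 0 := by omega
    have hn2 : n = 2 := by subst ht; rw [hq2] at hn; omega
    have hc1 : #{τ : K | τ ≠ 0} = 1 := by omega
    refine exists_arc_of_labels C {0} Label.InPair hq ?_ ?_ ?_ ?_ ?_ ?_ ?_
    · intro a b d c s hs hs'
      refine (card_inPair_onLineTwo_le _ C.σ a b d c s hs hs').trans ?_
      omega
    · intro a d ρ s hs hs'
      refine (card_inPair_onLineOne_le _ C.σ (mem_singleton_self 0) a d ρ s hs hs').trans ?_
      rw [hc1, ← hq]
      omega
    · intro d ρ s hs hs'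
      rw [eq_empty_of_forall_notMem (s := s), card_empty]
      · exact Nat.zero_le _
      · rintro (p | p) hp
        · exact hs' _ hp
        · rcases p with p | p <;> exact hs _ hp
    · rw [card_inPair, hc1, ← hq, hq2, hn2]
    · intro y w
      have : #{τ : K | Label.InPair (.inl (y, w, τ))} ≤
          #{τ : K | τ ≠ 0} := by
        refine card_le_card fun τ hτ => ?_
        rw [mem_filter] at hτ ⊢
        exact ⟨hτ.1, hτ.2.2⟩
      omega
    · intro w
      have : #{r : K | Label.InPair (.inr (.inl (w, r)))} = 0 := by
        rw [card_eq_zero, filter_eq_empty_iff]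
        exact fun _ _ h => h
      omega
    · rw [ht, card_eq_zero, filter_eq_empty_iff]
      exact fun _ _ h => h
  · have h2 := card_filter_ne_ne (zero_ne_one : (0 : K) ≠ 1)
    rw [← hq] at h2
    obtain ⟨e, he⟩ := card_pos.1
      (show 0 < #{x : K | x ≠ 0 ∧ x ≠ 1} by omega)
    obtain ⟨T, hT, hTt⟩ := exists_subset_card_eq
      (show t ≤ #{x : K | x ≠ 0 ∧ x ≠ 1} by omega)
    obtain ⟨-, he0, he1⟩ := mem_filter.1 he
    have hT0 : 0 ∉ T := fun h => (mem_filter.1 (hT h)).2.1 rfl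
    have hT1 : 1 ∉ T := fun h => (mem_filter.1 (hT h)).2.2 rfl
    have hn' := hn
    rw [← hTt, hq] at hn'
    refine exists_arc_of_labels C (exceptional T) (Label.Chosen T e) hq ?_ ?_ ?_ ?_ ?_ ?_ ?_
    · exact fun a b d c => card_onLineTwo_le C.σ_injective he0 he1 hT0 hT1 hn' a b d c
    · exact fun a d ρ => card_onLineOne_le C.σ hn' a d ρ
    · exact fun d ρ => card_onLineZero_le C.σ hT0 hT1 hn' d ρ
    · rw [card_chosen he0 he1 hT0 hT1 hn', hq]
    · intro y w
      have h : #{τ | Label.Chosen T e (.inl (y, w, τ))} + 2 = _ := card_chosen_inl T y w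
      rw [← hq] at h
      split_ifs at h <;> omega
    · intro w
      have h : #{r | Label.Chosen T e (.inr (.inl (w, r)))} + _ = _ :=
        card_chosen_zero T he0 he1 w
      rw [← hq] at h
      split_ifs at h <;> omega
    · rw [← hTt]
      congr 1
      ext r
      rw [mem_filter]
      exact ⟨fun h => h.2, fun h => ⟨mem_univ r, h⟩⟩

end Transfer

end PHG

/-! ### The main theorem. -/

theorem mainTheorem2 (R : Type*) [Ring R] [Finite R] (hR : IsChainRingOfLengthTwo R)
    (q n t : ℕ) (hq : q = residueOrder R)
    (hn₁ : (q : ℤ) ^ 2 - q ≤ n) (hn₂ : (n : ℤ) ≤ (q : ℤ) ^ 2 - 2)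
    (ht : (n : ℤ) = (q : ℤ) ^ 2 - q + t) :
    (∃ K : Set (PHG.Point R),
      PHG.IsArc K (q ^ 2 * n - 2 * q) n ∧
      ∃ 𝓢 : Set (Set (PHG.Point R)),
        (∀ S ∈ 𝓢, PHG.IsLineSegment S) ∧ 𝓢.PairwiseDisjoint id ∧
        𝓢.ncard = q * n - 2 ∧ K = ⋃₀ 𝓢 ∧
        ∃ z : PHG.Point R,
          {S ∈ 𝓢 | S ⊆ PHG.pointClass z}.ncard = t ∧
          ∀ x : PHG.Point R, ¬ PHG.Neighbour x z →
            q ≤ {S ∈ 𝓢 | S ⊆ PHG.pointClass x}.ncard + 3 ∧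
            {S ∈ 𝓢 | S ⊆ PHG.pointClass x}.ncard + 1 ≤ q) ∧
    (q : ℤ) * (q + 1) * n - (q : ℤ) ^ 3 + q * (q - 2 - t) ≤ PHG.maxArcSize R n := by
  classical
  have hn : n + q = q ^ 2 + t := by zify; linarith
  have htq : t + 2 ≤ q := by zify; linarith
  obtain ⟨_, ⟨C⟩⟩ := PHG.exists_chainCoordinates hR
  have := Finite.of_surjective _ (Submodule.Quotient.mk_surjective (Ring.jacobson R))
  let _ := Fintype.ofFinite (R ⧸ Ring.jacobson R)
  have h := C.exists_arc (hq.trans Nat.card_eq_fintype_card) hn htq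
  refine ⟨h, ?_⟩
  obtain ⟨X, hX, -⟩ := h
  have h1 := (PHG.isGreatest_maxArcSize (R := R) n).2 ⟨X, hX⟩
  have h2 : (q : ℤ) ^ 2 * n - 2 * q ≤ PHG.maxArcSize R n := by
    have : q ^ 2 * n ≤ PHG.maxArcSize R n + 2 * q := by omega
    zify at this
    linarith
  -- Substituting `n = q² - q + t` turns the claimed bound into exactly `q² n - 2q`.
  rw [ht] at h2 ⊢
  linarith
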